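/- Let $n\ge 1$, write $[n]=\{1,\dots,n\}$, and let $K\subseteq[n-1]$. Let $p=(p_1,\dots,p_n)\in\mathbb R^n$ have pairwise distinct entries, let $P_n$ be the convex hull of the points $(p_{w(1)},\dots,p_{w(n)})$, $w\in\mathfrak S_n$, and let $$P_n(K)=P_n\cap\bigcap_{k\in K}\{x\in\mathbb R^n : x_k\le x_{k+1}\}$$ be the partitioned permutohedron. For a polytope $P$ of dimension $d$ with $f_i$ nonempty faces of dimension $i$, let $h_P(t)=\sum_{i=0}^{d}f_i(t-1)^i$. For $w\in\mathfrak S_n$ call $i\in[n-1]$ a descent if $w(i)>w(i+1)$, and let $\mathrm{des}(w)$ be the number of descents. Say that $w$ has a double descent if $i$ and $i+1$ are both descents for some $i$, an initial descent if $1$ is a descent, and a final descent if $n-1$ is a descent. Let $W_K\le\mathfrak S_n$ be the subgroup generated by the transpositions $(k,k+1)$, $k\in K$. Let $W^K$ be the set of minimal length representatives of the left cosets $wW_K$, where permutations are composed from left to right (so $W_K$ permutes the values of the word $w(1)\cdots w(n)$), and the length of $w$ is the smallest number of adjacent transpositions whose product is $w$. Let $\widetilde{W^K}$ (respectively $\widehat{W^K}$)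 be the set of $w\in W^K$ with no double descent and no initial descent (respectively no double descent and no final descent). Then there are unique integers $\gamma_{n,j,K}$, $0\le j\le\lfloor\frac{n-1}2\rfloor$, with $$h_{P_n(K)}(t)=\sum_{j=0}^{\lfloor (n-1)/2\rfloor}\gamma_{n,j,K}\,t^j(1+t)^{n-1-2j},$$ and they are given by $$\gamma_{n,j,K}=\bigl|\{w\in\widetilde{W^K} : \mathrm{des}(w)=j\}\bigr|=\bigl|\{w\in\widehat{W^K} : \mathrm{des}(w)=j\}\bigr| ;$$ the last two counts agree for every integer $j\ge 0$. Equivalently, $$h_{P_n(K)}(t)=\sum_{w\in\widehat{W^K}}t^{\mathrm{des}(w)}(1+t)^{n-1-2\,\mathrm{des}(w)}.$$ In particular, every $\gamma_{n,j,K}$ is nonnegative. If $K=\emptyset$, then $W^K=\mathfrak S_n$ and $h_{P_n}(t)=\sum_{w\in\mathfrak S_n}t^{\mathrm{des}(w)}$, so that the expansion above is the one of Foata and Schützenberger for the Eulerian polynomial. -/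

import Mathlib

open Polynomial

noncomputable section

/-! ## Faces and the `h`-polynomial of a convex polytope -/

section Polytope

variable {E : Type*} [AddCommGroup E] [Module ℝ E] [TopologicalSpace E]

/-- The set of `i`-dimensional (nonempty) faces of `P`. A face is the set of points of `P` at which
some continuous linear functional attains its maximum over `P`; the zero functional gives the face
`P` itself. The dimension of a face is that of its affine span. -/
def facesOfDim (P : Set E) (i : ℕ) : Set (Set E) :=
  {F | F.Nonempty ∧ IsExposed ℝ P F ∧ Module.finrank ℝ (vectorSpan ℝ F) = i}

/-- `f_i(P)`, the number of `i`-dimensional faces of `P`. -/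
def faceNumber (P : Set E) (i : ℕ) : ℕ := (facesOfDim P i).ncard

/-- The `h`-polynomial `h_P(t) = ∑_{i=0}^{d} f_i (t - 1)^i`, where `d = dim P`. -/
def hPolynomial (P : Set E) : ℤ[X] :=
  ∑ i ∈ Finset.range (Module.finrank ℝ (vectorSpan ℝ P) + 1),
    C (faceNumber P i : ℤ) * (X - 1) ^ i

end Polytope

/-! ## Partitioned permutohedra

Throughout `n = m + 1`. The set `[n] = {1, …, n}` is modelled by `Fin (m + 1)` and the set
`[n - 1]` by `Fin m`, both shifted by one: `k : Fin m` stands for the pair of neighbours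
`k.castSucc`, `k.succ` in `Fin (m + 1)`. -/

/-- The permutohedron `P_n(p)`: the convex hull of the points `(p_{w(1)}, …, p_{w(n)})`, with `w`
ranging over all permutations. -/
def permutohedron {m : ℕ} (p : Fin (m + 1) → ℝ) : Set (Fin (m + 1) → ℝ) :=
  convexHull ℝ (Set.range fun w : Equiv.Perm (Fin (m + 1)) => p ∘ w)

/-- The partitioned permutohedron `P_n(K)`, cut out of `P_n(p)` by the inequalities
`x_k ≤ x_{k+1}` for `k ∈ K`. -/
def partitionedPermutohedron {m : ℕ} (p : Fin (m + 1) → ℝ) (K : Set (Fin m)) :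
    Set (Fin (m + 1) → ℝ) :=
  permutohedron p ∩ ⋂ k ∈ K, {x | x k.castSucc ≤ x k.succ}

/-! ## Descents -/

/-- The descent set of a permutation, read as the word `w(1) ⋯ w(n)`. -/
def descents {m : ℕ} (w : Equiv.Perm (Fin (m + 1))) : Finset (Fin m) :=
  {i | w i.succ < w i.castSucc}

/-- The number of descents. -/
def des {m : ℕ} (w : Equiv.Perm (Fin (m + 1))) : ℕ := (descents w).card

/-- Two consecutive positions are descents. -/
def HasDoubleDescent {m : ℕ} (w : Equiv.Perm (Fin (m + 1))) : Prop :=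
  ∃ i ∈ descents w, ∃ j ∈ descents w, (j : ℕ) = i + 1

/-- The first position is a descent. -/
def HasInitialDescent {m : ℕ} (w : Equiv.Perm (Fin (m + 1))) : Prop :=
  ∃ i ∈ descents w, (i : ℕ) = 0

/-- The last position (among the `m = n - 1` possible ones) is a descent. -/
def HasFinalDescent {m : ℕ} (w : Equiv.Perm (Fin (m + 1))) : Prop :=
  ∃ i ∈ descents w, (i : ℕ) + 1 = m

/-! ## Parabolic subgroups and minimal coset representatives -/

/-- The adjacent transposition `(k, k+1)`. -/
def adjTransposition {m : ℕ} (k : Fin m) : Equiv.Perm (Fin (m + 1)) :=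
  Equiv.swap k.castSucc k.succ

/-- The length of `w`: the smallest number of adjacent transpositions whose product is `w`. -/
def permLength {m : ℕ} (w : Equiv.Perm (Fin (m + 1))) : ℕ :=
  sInf {r | ∃ l : List (Fin m), (l.map adjTransposition).prod = w ∧ l.length = r}

/-- Every permutation is a product of adjacent transpositions, so that the infimum in
`permLength` is a minimum. -/
theorem exists_word {m : ℕ} (w : Equiv.Perm (Fin (m + 1))) :
    ∃ l : List (Fin m), (l.map adjTransposition).prod = w := by
  have h : w ∈ Submonoid.closure (Set.range (adjTransposition (m := m))) := by
    have := Equiv.Perm.mclosure_swap_castSucc_succ m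
    change Submonoid.closure (Set.range (adjTransposition (m := m))) = ⊤ at this
    rw [this]
    trivial
  induction h using Submonoid.closure_induction with
  | mem x hx => obtain ⟨k, rfl⟩ := hx; exact ⟨[k], by simp⟩
  | one => exact ⟨[], by simp⟩
  | mul x y _ _ hx hy =>
    obtain ⟨a, rfl⟩ := hx
    obtain ⟨b, rfl⟩ := hy
    exact ⟨a ++ b, by simp⟩

/-- The standard parabolic subgroup `W_K`. -/
def parabolic {m : ℕ} (K : Set (Fin m)) : Subgroup (Equiv.Perm (Fin (m + 1))) :=
  Subgroup.closure (adjTransposition '' K)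

/-- The set `W^K` of minimal length representatives of the cosets `w W_K`, where `w W_K` is formed
with permutations composed from left to right: its elements are "first `w`, then `u`" for
`u ∈ W_K`, which in Mathlib's right-to-left notation is `u * w`. Thus `W_K` permutes the values of
the word `w(1) ⋯ w(n)`. -/
def minCosetReps {m : ℕ} (K : Set (Fin m)) : Set (Equiv.Perm (Fin (m + 1))) :=
  {w | ∀ u ∈ parabolic K, permLength w ≤ permLength (u * w)}

/-- Elements of `W^K` with no double descent and no initial descent. -/
def tildeReps {m : ℕ} (K : Set (Fin m)) : Set (Equiv.Perm (Fin (m + 1))) :=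
  {w ∈ minCosetReps K | ¬ HasDoubleDescent w ∧ ¬ HasInitialDescent w}

/-- Elements of `W^K` with no double descent and no final descent. -/
def hatReps {m : ℕ} (K : Set (Fin m)) : Set (Equiv.Perm (Fin (m + 1))) :=
  {w ∈ minCosetReps K | ¬ HasDoubleDescent w ∧ ¬ HasFinalDescent w}

/-- The polynomial `∑_{j=0}^{⌊m/2⌋} γ_j t^j (1 + t)^{m - 2j}`. -/
def gammaExpansion (m : ℕ) (γ : ℕ → ℤ) : ℤ[X] :=
  ∑ j ∈ Finset.range (m / 2 + 1), C (γ j) * X ^ j * (1 + X) ^ (m - 2 * j)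

end

/-! Sorting `p` into a strictly increasing `q` does not change the polytope. By Rado's theorem it is
cut out by one equation, the inequalities `∑_{i∈S} x_i ≥ q_1 + ⋯ + q_|S|`, and `x_k ≤ x_{k+1}` for
`k ∈ K`. A nonempty face is determined by the inequalities tight at a relative interior point. Since
the entries of `q` are distinct, the possible tight sets are the pairs `(C, J)`: a chain `C` of
nonempty proper subsets never containing `k + 1` without `k` for `k ∈ K`, and a set `J ⊆ K` of
neighbours that `C` does not separate (`isFaceDatum_tight`, `exists_tight_eq`). Such a face has
dimension `m - |C| - |J|` (`finrank_direction`), so `h` is the sum of `(t - 1)^(m - |C| - |J|)` over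
these pairs and does not depend on `p`.

A chain `C` cuts the letters into ordered blocks. If `B` is the set of `k ∈ K` whose neighbours
share a block, the sum over `J` is `t^|B| (t - 1)^(m - |C| - |B|)`. Expanding the power of `t - 1`
gives a signed sum over sets `R` of letters that are not minimal in their block. Each `R` encodes a
word running through the blocks in order, where a block first decreases through its letters from `R`
and then increases; `R` avoids `k + 1` for `k ∈ B` exactly when `k` precedes `k + 1` for all `k ∈
K`. The weight is `-1` per descent and `t` per ascent inside blocks (`sum_cutWeight_uncut`,
`sum_subsets_nonMinima`).

Exchanging the sums, a fixed word is summed over all ways to cut it into pieces without a peak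
(`sum_isProperChain_uncut`). A descent not preceded by an ascent makes this sum vanish; otherwise
every ascent-descent pair contributes `t` and every other ascent `1 + t` (`cutSum_eq_zero`,
`two_mul_card_le_and_cutSum_eq`). The words in question are the minimal coset representatives, by
counting inversions (`mem_minCosetReps_iff`).

The version with final descents comes from a reversal symmetry of the face data, and uniqueness from
triangularity (`gammaExpansion_injective`). For `K = ∅` each chain is instead charged to its one
compatible word that decreases on every block, which gives the Eulerian polynomial. -/

/-! ## Faces of polyhedra -/

/-- A finite system consisting of one linear equation and of linear inequalities. -/
structure LinearSystem (E ι : Type*) [AddCommGroup E] [Module ℝ E] [TopologicalSpace E] where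
  /-- the functional of the equation -/
  eqn : StrongDual ℝ E
  /-- the right hand side of the equation -/
  rhs : ℝ
  /-- the indices of the inequalities -/
  index : Finset ι
  /-- the functionals of the inequalities -/
  ineq : ι → StrongDual ℝ E
  /-- the lower bounds of the inequalities -/
  bound : ι → ℝ

namespace LinearSystem

open scoped Classical in
/-- The indices of the inequalities that are equalities at `x`. -/
noncomputable def tight {E ι : Type*} [AddCommGroup E] [Module ℝ E] [TopologicalSpace E]
    (A : LinearSystem E ι) (x : E) : Finset ι :=
  A.index.filter fun i => A.ineq i x = A.bound i

variable {E ι : Type*} [AddCommGroup E] [Module ℝ E] [TopologicalSpace E] (A : LinearSystem E ι)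

/-- The set of solutions. -/
def solutions : Set E := {x | A.eqn x = A.rhs ∧ ∀ i ∈ A.index, A.bound i ≤ A.ineq i x}

/-- The solutions at which all inequalities of `T` are equalities. -/
def face (T : Finset ι) : Set E := {x ∈ A.solutions | T ⊆ A.tight x}

/-- The solutions of the homogeneous equations belonging to `T`. -/
def direction (T : Finset ι) : Submodule ℝ E :=
  (A.eqn : E →ₗ[ℝ] ℝ).ker ⊓ ⨅ i ∈ T, (A.ineq i : E →ₗ[ℝ] ℝ).ker

variable {A}

theorem mem_tight {x : E} {i : ι} : i ∈ A.tight x ↔ i ∈ A.index ∧ A.ineq i x = A.bound i := by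
  simp [tight]

theorem tight_subset (x : E) : A.tight x ⊆ A.index := fun _ hi => (mem_tight.1 hi).1

theorem mem_direction {T : Finset ι} {v : E} :
    v ∈ A.direction T ↔ A.eqn v = 0 ∧ ∀ i ∈ T, A.ineq i v = 0 := by
  simp [direction, Submodule.mem_iInf]

theorem mem_face_tight {x : E} (hx : x ∈ A.solutions) : x ∈ A.face (A.tight x) :=
  ⟨hx, Finset.Subset.refl _⟩

/-- Inequalities with slack at `x` survive a short step, so only the tight ones restrict `v`. -/
theorem exists_add_smul_mem {x v : E} (hx : x ∈ A.solutions) (h0 : A.eqn v = 0)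
    (hv : ∀ i ∈ A.tight x, 0 ≤ A.ineq i v) :
    ∃ ε : ℝ, 0 < ε ∧ x + ε • v ∈ A.solutions ∧
      ∀ i, i ∈ A.tight (x + ε • v) ↔ i ∈ A.tight x ∧ A.ineq i v = 0 := by
  have key : ∀ᶠ ε : ℝ in nhdsWithin 0 (Set.Ioi 0), ∀ i ∈ A.index, i ∉ A.tight x →
      A.bound i < A.ineq i x + ε * A.ineq i v := by
    rw [Filter.eventually_all_finset]
    intro i hi
    by_cases hT : i ∈ A.tight x
    · exact Filter.Eventually.of_forall fun _ h => absurd hT h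
    · have h1 : A.bound i < A.ineq i x :=
        lt_of_le_of_ne (hx.2 i hi) fun h => hT (mem_tight.2 ⟨hi, h.symm⟩)
      have h2 : Filter.Tendsto (fun ε : ℝ => A.ineq i x + ε * A.ineq i v) (nhds 0)
          (nhds (A.ineq i x + 0 * A.ineq i v)) :=
        Continuous.tendsto (by fun_prop) 0
      rw [zero_mul, add_zero] at h2
      filter_upwards [(h2.mono_left nhdsWithin_le_nhds).eventually (lt_mem_nhds h1)] with ε hε _
      exact hε
  obtain ⟨ε, hε, hpos⟩ := (key.and self_mem_nhdsWithin).exists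
  have hpos : 0 < ε := hpos
  have hval : ∀ i, A.ineq i (x + ε • v) = A.ineq i x + ε * A.ineq i v := by
    intro i; simp
  refine ⟨ε, hpos, ⟨by simp [h0, hx.1], fun i hi => ?_⟩, fun i => ?_⟩
  · rw [hval]
    by_cases hT : i ∈ A.tight x
    · rw [(mem_tight.1 hT).2]
      have := mul_nonneg hpos.le (hv i hT)
      linarith
    · exact (hε i hi hT).le
  · rw [mem_tight, hval]
    constructor
    · rintro ⟨hi, h⟩
      have hT : i ∈ A.tight x := by
        by_contra hT
        exact (hε i hi hT).ne' h
      refine ⟨hT, ?_⟩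
      rw [(mem_tight.1 hT).2] at h
      have : ε * A.ineq i v = 0 := by linarith
      exact (mul_eq_zero.1 this).resolve_left hpos.ne'
    · rintro ⟨hT, h⟩
      rw [h, mul_zero, add_zero]
      exact mem_tight.1 hT

theorem isExposed_face (T : Finset ι) (hT : T ⊆ A.index) : IsExposed ℝ A.solutions (A.face T) := by
  rintro ⟨z, hz⟩
  -- Each summand is at least its bound, so the sum reaches the sum of the bounds only where all of
  -- `T` is tight; `z` shows that this minimum is attained.
  refine ⟨-∑ i ∈ T, A.ineq i, ?_⟩
  have hsum : ∀ x ∈ A.solutions, ∑ i ∈ T, A.bound i ≤ ∑ i ∈ T, A.ineq i x := fun x hx =>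
    Finset.sum_le_sum fun i hi => hx.2 i (hT hi)
  have heq : ∀ x ∈ A.face T, ∑ i ∈ T, A.ineq i x = ∑ i ∈ T, A.bound i := fun x hx =>
    Finset.sum_congr rfl fun i hi => (mem_tight.1 (hx.2 hi)).2
  ext x
  simp only [Set.mem_ofPred_eq, neg_apply, sum_apply,
    neg_le_neg_iff]
  constructor
  · intro hx
    refine ⟨hx.1, fun y hy => ?_⟩
    rw [heq x hx]
    exact hsum y hy
  · rintro ⟨hx, h⟩
    refine ⟨hx, fun i hi => mem_tight.2 ⟨hT hi, ?_⟩⟩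
    have h1 : ∑ i ∈ T, A.bound i = ∑ i ∈ T, A.ineq i x :=
      le_antisymm (hsum x hx) ((h z hz.1).trans (heq z hz).le)
    exact ((Finset.sum_eq_sum_iff_of_le fun i hi => hx.2 i (hT hi)).1 h1 i hi).symm

theorem tight_midpoint {x y : E} (hx : x ∈ A.solutions) (hy : y ∈ A.solutions) {i : ι}
    (hi : i ∈ A.tight ((2⁻¹ : ℝ) • (x + y))) : i ∈ A.tight x ∧ i ∈ A.tight y := by
  obtain ⟨hi, h⟩ := mem_tight.1 hi
  simp only [map_smul, map_add, smul_eq_mul] at h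
  have h1 := hx.2 i hi
  have h2 := hy.2 i hi
  exact ⟨mem_tight.2 ⟨hi, by linarith⟩, mem_tight.2 ⟨hi, by linarith⟩⟩

theorem midpoint_mem {x y : E} (hx : x ∈ A.solutions) (hy : y ∈ A.solutions) :
    (2⁻¹ : ℝ) • (x + y) ∈ A.solutions := by
  refine ⟨?_, fun i hi => ?_⟩
  · simp only [map_smul, map_add, smul_eq_mul, hx.1, hy.1]; ring
  · simp only [map_smul, map_add, smul_eq_mul]
    have h1 := hx.2 i hi
    have h2 := hy.2 i hi
    linarith

/-- A point of `F` with the fewest tight inequalities serves as a relative interior point: its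
midpoint with any other point of `F` cannot have fewer. -/
theorem exists_eq_face {F : Set E} (hne : F.Nonempty) (hF : IsExposed ℝ A.solutions F) :
    ∃ x ∈ A.solutions, F = A.face (A.tight x) := by
  obtain ⟨l, hl⟩ := hF hne
  obtain ⟨x, hxF, hmin⟩ : ∃ x ∈ F, ∀ y ∈ F, (A.tight x).card ≤ (A.tight y).card := by
    have hwf := (measure fun y : E => (A.tight y).card).wf
    exact ⟨hwf.min F hne, hwf.min_mem F hne, fun y hy => not_lt.1 (hwf.not_lt_min F hy)⟩
  have hx : x ∈ A.solutions ∧ ∀ y ∈ A.solutions, l y ≤ l x := by rw [hl] at hxF; exact hxF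
  refine ⟨x, hx.1, Set.Subset.antisymm (fun y hy => ?_) (fun y hy => ?_)⟩
  · have hy' : y ∈ A.solutions ∧ ∀ z ∈ A.solutions, l z ≤ l y := by rw [hl] at hy; exact hy
    have hm : (2⁻¹ : ℝ) • (x + y) ∈ F := by
      rw [hl]
      refine ⟨midpoint_mem hx.1 hy'.1, fun z hz => ?_⟩
      simp only [map_smul, map_add, smul_eq_mul]
      have h1 := hx.2 z hz
      have h2 := hy'.2 z hz
      linarith
    have hsub : A.tight ((2⁻¹ : ℝ) • (x + y)) ⊆ A.tight x :=
      fun i hi => (tight_midpoint hx.1 hy'.1 hi).1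
    have := Finset.eq_of_subset_of_card_le hsub (hmin _ hm)
    exact ⟨hy'.1, fun i hi => (tight_midpoint hx.1 hy'.1 (this ▸ hi)).2⟩
  -- All inequalities tight at `x` are tight at `y`, so one can move from `x` slightly away from
  -- `y`; maximality of `l` at `x` then gives `l x ≤ l y`.
  · obtain ⟨ε, hε, hmem, -⟩ := exists_add_smul_mem (v := x - y) hx.1
      (by rw [map_sub, hx.1.1, hy.1.1, sub_self])
      (fun i hi => by
        rw [map_sub, (mem_tight.1 hi).2, (mem_tight.1 (hy.2 hi)).2, sub_self])
    have h := hx.2 _ hmem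
    simp only [map_smul, map_add, map_sub, smul_eq_mul] at h
    have h' : l x ≤ l y := by
      by_contra hc
      have := mul_pos hε (sub_pos.2 (not_le.1 hc))
      linarith
    rw [hl]
    exact ⟨hy.1, fun z hz => (hx.2 z hz).trans h'⟩

theorem vectorSpan_face {x : E} (hx : x ∈ A.solutions) :
    vectorSpan ℝ (A.face (A.tight x)) = A.direction (A.tight x) := by
  apply le_antisymm
  · rw [vectorSpan_def, Submodule.span_le]
    rintro _ ⟨y, hy, z, hz, rfl⟩
    refine mem_direction.2 ⟨?_, fun i hi => ?_⟩
    · simp [hy.1.1, hz.1.1]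
    · simp [(mem_tight.1 (hy.2 hi)).2, (mem_tight.1 (hz.2 hi)).2]
  · intro v hv
    obtain ⟨h0, hT⟩ := mem_direction.1 hv
    obtain ⟨ε, hε, hmem, htight⟩ := exists_add_smul_mem hx h0 fun i hi => (hT i hi).ge
    have h1 : x + ε • v ∈ A.face (A.tight x) :=
      ⟨hmem, fun i hi => (htight i).2 ⟨hi, hT i hi⟩⟩
    have h2 := vsub_mem_vectorSpan ℝ h1 (mem_face_tight hx)
    simp only [vsub_eq_sub, add_sub_cancel_left] at h2
    exact (Submodule.smul_mem_iff _ hε.ne').1 h2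

theorem tight_eq_of_face_eq {x y : E} (hx : x ∈ A.solutions) (hy : y ∈ A.solutions)
    (h : A.face (A.tight x) = A.face (A.tight y)) : A.tight x = A.tight y := by
  have h1 := mem_face_tight hx
  have h2 := mem_face_tight hy
  rw [h] at h1
  rw [← h] at h2
  exact Finset.Subset.antisymm h2.2 h1.2

variable (A)

open scoped Classical in
/-- The sets of all inequalities that are equalities at some solution. -/
noncomputable def tightSets : Finset (Finset ι) :=
  A.index.powerset.filter fun T => ∃ x ∈ A.solutions, A.tight x = T

variable {A}

theorem mem_tightSets {T : Finset ι} : T ∈ A.tightSets ↔ ∃ x ∈ A.solutions, A.tight x = T := by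
  simp only [tightSets, Finset.mem_filter, Finset.mem_powerset, and_iff_right_iff_imp]
  rintro ⟨x, -, rfl⟩
  exact tight_subset x

theorem faceNumber_solutions (i : ℕ) :
    faceNumber A.solutions i =
      (A.tightSets.filter fun T => Module.finrank ℝ (A.direction T) = i).card := by
  have h : facesOfDim A.solutions i =
      A.face '' (A.tightSets.filter fun T => Module.finrank ℝ (A.direction T) = i) := by
    ext F
    simp only [facesOfDim, Set.mem_ofPred_eq, Set.mem_image, Finset.mem_coe, Finset.mem_filter,
      mem_tightSets]
    constructor
    · rintro ⟨hne, hF, hd⟩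
      obtain ⟨x, hx, rfl⟩ := exists_eq_face hne hF
      rw [vectorSpan_face hx] at hd
      exact ⟨_, ⟨⟨x, hx, rfl⟩, hd⟩, rfl⟩
    · rintro ⟨_, ⟨⟨x, hx, rfl⟩, hd⟩, rfl⟩
      refine ⟨⟨x, mem_face_tight hx⟩, isExposed_face _ (tight_subset x), ?_⟩
      rwa [vectorSpan_face hx]
  rw [faceNumber, h, Set.InjOn.ncard_image, Set.ncard_coe_finset]
  intro T hT T' hT' hTT
  simp only [Finset.mem_coe, Finset.mem_filter, mem_tightSets] at hT hT'
  obtain ⟨⟨x, hx, rfl⟩, -⟩ := hT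
  obtain ⟨⟨y, hy, rfl⟩, -⟩ := hT'
  exact tight_eq_of_face_eq hx hy hTT

theorem hPolynomial_solutions [FiniteDimensional ℝ E] :
    hPolynomial A.solutions =
      ∑ T ∈ A.tightSets, (X - 1) ^ Module.finrank ℝ (A.direction T) := by
  have hmaps : ∀ T ∈ A.tightSets, Module.finrank ℝ (A.direction T) ∈
      Finset.range (Module.finrank ℝ (vectorSpan ℝ A.solutions) + 1) := by
    intro T hT
    obtain ⟨x, hx, rfl⟩ := mem_tightSets.1 hT
    rw [Finset.mem_range, Nat.lt_succ_iff, ← vectorSpan_face hx]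
    exact Submodule.finrank_mono (vectorSpan_mono ℝ fun y hy => hy.1)
  rw [hPolynomial, ← Finset.sum_fiberwise_of_maps_to hmaps]
  refine Finset.sum_congr rfl fun i _ => ?_
  rw [faceNumber_solutions, Finset.sum_congr rfl (g := fun _ => (X - 1 : ℤ[X]) ^ i), Finset.sum_const]
  · simp
  · intro T hT
    rw [(Finset.mem_filter.1 hT).2]

end LinearSystem

theorem LinearSystem.convex_solutions {E ι : Type*} [AddCommGroup E] [Module ℝ E]
    [TopologicalSpace E] (A : LinearSystem E ι) : Convex ℝ A.solutions := by
  intro x hx y hy a b ha hb hab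
  refine ⟨?_, fun i hi => ?_⟩
  · simp only [map_add, map_smul, smul_eq_mul, hx.1, hy.1]
    rw [← add_mul, hab, one_mul]
  · simp only [map_add, map_smul, smul_eq_mul]
    have h1 := mul_le_mul_of_nonneg_left (hx.2 i hi) ha
    have h2 := mul_le_mul_of_nonneg_left (hy.2 i hi) hb
    have h3 : A.bound i = a * A.bound i + b * A.bound i := by rw [← add_mul, hab, one_mul]
    linarith

/-! ## The inequalities of the permutohedron -/

/-- The sum of the first `s` entries of `q`. -/
noncomputable def lowSum {m : ℕ} (q : Fin (m + 1) → ℝ) (s : ℕ) : ℝ := ∑ i with i.val < s, q i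

theorem lowSum_succ {m : ℕ} (q : Fin (m + 1) → ℝ) {s : ℕ} (hs : s < m + 1) :
    lowSum q (s + 1) = lowSum q s + q ⟨s, hs⟩ := by
  have : (Finset.univ.filter fun i : Fin (m + 1) => i.val < s + 1) =
      insert ⟨s, hs⟩ (Finset.univ.filter fun i : Fin (m + 1) => i.val < s) := by
    ext i
    simp only [Finset.mem_filter, Finset.mem_univ, true_and, Finset.mem_insert, Fin.ext_iff]
    omega
  rw [lowSum, this, Finset.sum_insert (by simp), add_comm, lowSum]

/-- The largest element of a set has at least as many indices below it as the set has other
elements, so its entry dominates the next term of `lowSum`. -/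
theorem lowSum_card_le_sum {m : ℕ} {q : Fin (m + 1) → ℝ} (hq : Monotone q)
    (S : Finset (Fin (m + 1))) : lowSum q S.card ≤ ∑ i ∈ S, q i := by
  induction S using Finset.induction_on_max with
  | empty => simp [lowSum]
  | insert a S ha ih =>
    have hnot : a ∉ S := fun h => lt_irrefl _ (ha a h)
    have hcard : S.card ≤ a.val := by
      have : S ⊆ Finset.Iio a := fun i hi => Finset.mem_Iio.2 (ha i hi)
      simpa using Finset.card_le_card this
    rw [Finset.card_insert_of_notMem hnot, Finset.sum_insert hnot,
      lowSum_succ q (lt_of_le_of_lt hcard a.isLt), add_comm]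
    exact add_le_add (hq (Fin.le_def.2 hcard)) ih

/-- Abel summation: replacing a coefficient by the next smaller one costs their difference times a
nonnegative partial sum. -/
theorem mul_sum_le_sum_mul {m : ℕ} {c y : Fin (m + 1) → ℝ} (hc : Antitone c)
    (hy : ∀ i, 0 ≤ ∑ j ∈ Finset.Iic i, y j) :
    c (Fin.last m) * ∑ i, y i ≤ ∑ i, c i * y i := by
  induction m with
  | zero => simp
  | succ m ih =>
    have hy' : ∀ i : Fin (m + 1), 0 ≤ ∑ j ∈ Finset.Iic i, y j.castSucc := by
      intro i
      have := hy i.castSucc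
      rwa [← Fin.map_castSuccEmb_Iic, Finset.sum_map] at this
    have h1 := ih (c := fun i => c i.castSucc) (y := fun i => y i.castSucc)
      (fun i j hij => hc (Fin.castSucc_le_castSucc_iff.2 hij)) hy'
    have h2 : 0 ≤ ∑ i : Fin (m + 1), y i.castSucc := by
      have := hy' (Fin.last m)
      rwa [← Fin.top_eq_last, Finset.Iic_top] at this
    have h3 : c (Fin.last (m + 1)) ≤ c (Fin.last m).castSucc := hc (Fin.le_last _)
    rw [Fin.sum_univ_castSucc, Fin.sum_univ_castSucc (fun i => c i * y i)]
    have h4 := mul_le_mul_of_nonneg_right h3 h2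
    linarith

/-- The inequalities describing the partitioned permutohedron. -/
noncomputable def permutohedronSystem {m : ℕ} (q : Fin (m + 1) → ℝ) (K : Finset (Fin m)) :
    LinearSystem (Fin (m + 1) → ℝ) (Finset (Fin (m + 1)) ⊕ Fin m) where
  eqn := ∑ i, ContinuousLinearMap.proj i
  rhs := ∑ i, q i
  index := (Finset.univ.filter fun S : Finset (Fin (m + 1)) =>
    S.Nonempty ∧ S ≠ Finset.univ).disjSum K
  ineq := Sum.elim (fun S => ∑ i ∈ S, ContinuousLinearMap.proj i)
    (fun k => ContinuousLinearMap.proj (R := ℝ) (φ := fun _ => ℝ) k.succ -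
    ContinuousLinearMap.proj k.castSucc)
  bound := Sum.elim (fun S => lowSum q S.card) fun _ => 0

theorem mem_solutions_permutohedronSystem {m : ℕ} {q : Fin (m + 1) → ℝ} {K : Finset (Fin m)}
    {x : Fin (m + 1) → ℝ} :
    x ∈ (permutohedronSystem q K).solutions ↔ ∑ i, x i = ∑ i, q i ∧
      (∀ S : Finset (Fin (m + 1)), S.Nonempty → S ≠ Finset.univ →
        lowSum q S.card ≤ ∑ i ∈ S, x i) ∧ ∀ k ∈ K, x k.castSucc ≤ x k.succ := by
  simp only [LinearSystem.solutions, permutohedronSystem, Set.mem_ofPred_eq, sum_apply,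
    ContinuousLinearMap.proj_apply]
  refine and_congr_right fun _ => ⟨fun h => ⟨fun S h1 h2 => ?_, fun k hk => ?_⟩, ?_⟩
  · simpa using h (Sum.inl S) (by simp [h1, h2])
  · simpa using h (Sum.inr k) (by simpa using hk)
  · rintro ⟨h1, h2⟩ (S | k) hi
    · have : S.Nonempty ∧ S ≠ Finset.univ := by simpa using hi
      simpa using h1 S this.1 this.2
    · simpa using h2 k (by simpa using hi)

theorem lowSum_eq_sum {m : ℕ} (q : Fin (m + 1) → ℝ) : lowSum q (m + 1) = ∑ i, q i := by
  rw [lowSum, Finset.filter_true_of_mem fun i _ => i.isLt]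

/-- Rado's theorem. A functional separating a solution from the hull would be smaller at the
solution than at every vertex. The vertex pairing small entries of `q` with large coefficients
contradicts this, by Abel summation. -/
theorem permutohedron_eq_solutions {m : ℕ} {q : Fin (m + 1) → ℝ} (hq : Monotone q) :
    permutohedron q = (permutohedronSystem q ∅).solutions := by
  apply Set.Subset.antisymm
  · refine convexHull_min ?_ (LinearSystem.convex_solutions _)
    rintro _ ⟨w, rfl⟩
    refine mem_solutions_permutohedronSystem.2 ⟨?_, fun S _ _ => ?_, by simp⟩
    · exact Equiv.sum_comp w q
    · have := lowSum_card_le_sum hq (S.map w.toEmbedding)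
      simpa using this
  · intro x hx
    obtain ⟨hsum, hS, -⟩ := mem_solutions_permutohedronSystem.1 hx
    by_contra hnot
    have hclosed : IsClosed (permutohedron q) :=
      ((Set.finite_range _).isCompact_convexHull ℝ).isClosed
    obtain ⟨f, u, hfx, hfu⟩ :=
      geometric_hahn_banach_point_closed (convex_convexHull ℝ _) hclosed hnot
    set c : Fin (m + 1) → ℝ := fun i => f (Pi.single i 1) with hc
    have hf : ∀ y, f y = ∑ i, c i * y i := by
      intro y
      conv_lhs => rw [← Finset.univ_sum_single y, map_sum]
      refine Finset.sum_congr rfl fun i _ => ?_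
      have : (Pi.single i (y i) : Fin (m + 1) → ℝ) = y i • Pi.single i 1 := by
        rw [← Pi.single_smul, smul_eq_mul, mul_one]
      rw [this, map_smul, smul_eq_mul, mul_comm]
    set σ := Tuple.sort fun i => -c i with hσ
    have hmono : Antitone fun i => c (σ i) := by
      intro i j hij
      have := Tuple.monotone_sort (fun i => -c i) hij
      simpa using this
    have hcard : ∀ i : Fin (m + 1), ((Finset.Iic i).map σ.toEmbedding).card = i.val + 1 := by
      intro i; simp
    have hlow : ∀ i : Fin (m + 1), ∑ j ∈ Finset.Iic i, q j = lowSum q (i.val + 1) := by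
      intro i
      refine Finset.sum_congr ?_ fun _ _ => rfl
      ext j
      simp only [Finset.mem_Iic, Finset.mem_filter, Finset.mem_univ, true_and, Fin.le_def]
      omega
    have htot : ∑ i, x (σ i) = ∑ i, q i := (Equiv.sum_comp σ x).trans hsum
    have hpart : ∀ i, 0 ≤ ∑ j ∈ Finset.Iic i, (x (σ j) - q j) := by
      intro i
      by_cases hi : i = Fin.last m
      · rw [hi, ← Fin.top_eq_last, Finset.Iic_top, Finset.sum_sub_distrib, htot, sub_self]
      · have h1 := hS ((Finset.Iic i).map σ.toEmbedding) (by simp) fun h => by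
          have h2 := hcard i
          rw [h, Finset.card_univ, Fintype.card_fin] at h2
          exact hi (Fin.ext (by simp; omega))
        rw [hcard, Finset.sum_map] at h1
        rw [Finset.sum_sub_distrib, hlow, sub_nonneg]
        exact h1
    have habel := mul_sum_le_sum_mul hmono hpart
    rw [Finset.sum_sub_distrib, htot, sub_self, mul_zero] at habel
    have hvert : q ∘ (σ⁻¹ : Equiv.Perm _) ∈ permutohedron q :=
      subset_convexHull ℝ _ ⟨σ⁻¹, rfl⟩
    have h1 := hfu _ hvert
    have h2 : f x = ∑ i, c (σ i) * x (σ i) := by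
      rw [hf, ← Equiv.sum_comp σ]
    have h3 : f (q ∘ (σ⁻¹ : Equiv.Perm _)) = ∑ i, c (σ i) * q i := by
      rw [hf, ← Equiv.sum_comp σ]
      simp
    simp only [mul_sub, Finset.sum_sub_distrib] at habel
    linarith

theorem partitionedPermutohedron_eq_solutions {m : ℕ} {q : Fin (m + 1) → ℝ} (hq : Monotone q)
    (K : Finset (Fin m)) :
    partitionedPermutohedron q K = (permutohedronSystem q K).solutions := by
  ext x
  rw [partitionedPermutohedron, permutohedron_eq_solutions hq, Set.mem_inter_iff,
    mem_solutions_permutohedronSystem, mem_solutions_permutohedronSystem]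
  simp only [Finset.notMem_empty, false_imp_iff, implies_true, and_true, Finset.mem_coe,
    Set.mem_iInter, Set.mem_ofPred_eq, and_assoc]

theorem permutohedron_comp {m : ℕ} (p : Fin (m + 1) → ℝ) (σ : Equiv.Perm (Fin (m + 1))) :
    permutohedron (p ∘ σ) = permutohedron p := by
  rw [permutohedron, permutohedron]
  congr 1
  ext x
  constructor
  · rintro ⟨w, rfl⟩
    exact ⟨σ * w, by ext; simp⟩
  · rintro ⟨w, rfl⟩
    exact ⟨σ⁻¹ * w, by ext; simp⟩

/-! ## Chains of subsets and their level functions -/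

/-- A chain of nonempty proper subsets. -/
structure IsProperChain {α : Type*} [Fintype α] (C : Finset (Finset α)) : Prop where
  nonempty : ∀ S ∈ C, S.Nonempty
  ne_univ : ∀ S ∈ C, S ≠ Finset.univ
  total : ∀ S ∈ C, ∀ T ∈ C, S ⊆ T ∨ T ⊆ S

/-- The number of members of `C` that do not contain `v`. -/
def level {α : Type*} [DecidableEq α] (C : Finset (Finset α)) (v : α) : ℕ :=
  (C.filter fun S => v ∉ S).card

section Chains

variable {α : Type*} [Fintype α] [DecidableEq α] {C : Finset (Finset α)}

theorem IsProperChain.level_lt_iff (hC : IsProperChain C) {u v : α} :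
    level C u < level C v ↔ ∃ S ∈ C, u ∈ S ∧ v ∉ S := by
  constructor
  · intro h
    by_contra! hcon
    refine h.not_ge (Finset.card_le_card fun S hS => ?_)
    rw [Finset.mem_filter] at hS ⊢
    exact ⟨hS.1, fun hu => hS.2 (hcon S hS.1 hu)⟩
  · rintro ⟨S, hS, hu, hv⟩
    refine Finset.card_lt_card ⟨fun T hT => ?_, fun h => ?_⟩
    · rw [Finset.mem_filter] at hT ⊢
      refine ⟨hT.1, fun hvT => ?_⟩
      rcases hC.total S hS T hT.1 with h | h
      · exact hT.2 (h hu)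
      · exact hv (h hvT)
    · exact (Finset.mem_filter.1 (h (Finset.mem_filter.2 ⟨hS, hv⟩))).2 hu

theorem IsProperChain.level_le_iff (hC : IsProperChain C) {u v : α} :
    level C u ≤ level C v ↔ ∀ S ∈ C, v ∈ S → u ∈ S := by
  rw [← not_lt, hC.level_lt_iff]
  push Not
  rfl

theorem IsProperChain.level_eq_iff (hC : IsProperChain C) {u v : α} :
    level C u = level C v ↔ ∀ S ∈ C, u ∈ S ↔ v ∈ S := by
  rw [le_antisymm_iff, hC.level_le_iff, hC.level_le_iff]
  exact ⟨fun h S hS => ⟨h.2 S hS, h.1 S hS⟩, fun h => ⟨fun S hS => (h S hS).2,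
    fun S hS => (h S hS).1⟩⟩

/-- A set comparable with all members of a chain is separated from the other members by two
points. -/
theorem IsProperChain.exists_separating (hC : IsProperChain C) {S : Finset α} (h1 : S.Nonempty)
    (h2 : S ≠ Finset.univ) (h : ∀ T ∈ C, S ⊆ T ∨ T ⊆ S) :
    ∃ v ∈ S, ∃ u ∉ S, ∀ T ∈ C, T ≠ S → (v ∈ T ↔ u ∈ T) := by
  -- `v` is taken from the last block that meets `S`, and `u` from the first block that meets its
  -- complement.
  obtain ⟨v, hv, hvmax⟩ := S.exists_max_image (level C) h1
  have hc : Sᶜ.Nonempty := by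
    rw [Finset.nonempty_iff_ne_empty, Ne, Finset.compl_eq_empty_iff]
    exact h2
  obtain ⟨u, hu, humin⟩ := Sᶜ.exists_min_image (level C) hc
  rw [Finset.mem_compl] at hu
  refine ⟨v, hv, u, hu, fun T hT hne => ?_⟩
  rcases h T hT with hST | hTS
  · obtain ⟨u', hu', hn⟩ := Finset.exists_of_ssubset (hST.ssubset_of_ne (Ne.symm hne))
    have := hC.level_le_iff.1 (humin u' (Finset.mem_compl.2 hn)) T hT hu'
    exact ⟨fun _ => this, fun _ => hST hv⟩
  · obtain ⟨v', hv', hn⟩ := Finset.exists_of_ssubset (hTS.ssubset_of_ne hne)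
    exact ⟨fun hvT => absurd (hC.level_le_iff.1 (hvmax v' hv') T hT hvT) hn,
      fun huT => absurd (hTS huT) hu⟩

end Chains

/-- The combinatorial data of a face of the partitioned permutohedron: a chain of sets on which the
coordinate sums are minimal and a set of equalities `x_k = x_{k+1}`. -/
structure IsFaceDatum {m : ℕ} (K : Finset (Fin m)) (C : Finset (Finset (Fin (m + 1))))
    (J : Finset (Fin m)) : Prop where
  chain : IsProperChain C
  subset : J ⊆ K
  mem_of_succ_mem : ∀ S ∈ C, ∀ k ∈ K, k.succ ∈ S → k.castSucc ∈ S
  succ_mem : ∀ S ∈ C, ∀ k ∈ J, k.castSucc ∈ S → k.succ ∈ S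

/-! ### Tight inequalities at a point -/

section Tight

variable {m : ℕ} {q : Fin (m + 1) → ℝ} {K : Finset (Fin m)} {x : Fin (m + 1) → ℝ}

theorem lowSum_card_le (hx : x ∈ (permutohedronSystem q K).solutions)
    (S : Finset (Fin (m + 1))) : lowSum q S.card ≤ ∑ i ∈ S, x i := by
  obtain ⟨h0, hS, -⟩ := mem_solutions_permutohedronSystem.1 hx
  rcases S.eq_empty_or_nonempty with rfl | h1
  · simp [lowSum]
  by_cases h2 : S = Finset.univ
  · rw [h2, Finset.card_univ, Fintype.card_fin, lowSum_eq_sum, h0]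
  · exact hS S h1 h2

/-- Without `v` the sum is still at least `lowSum q (S.card - 1)`, so `x v` is at most the
difference of two consecutive values of `lowSum`. -/
theorem le_of_mem_of_sum_eq (hx : x ∈ (permutohedronSystem q K).solutions)
    {S : Finset (Fin (m + 1))} (hS : ∑ i ∈ S, x i = lowSum q S.card) {v i : Fin (m + 1)}
    (hv : v ∈ S) (hi : i.val + 1 = S.card) : x v ≤ q i := by
  have h1 := lowSum_card_le hx (S.erase v)
  rw [Finset.card_erase_of_mem hv, ← hi, Nat.add_sub_cancel] at h1
  have h2 := Finset.add_sum_erase S x hv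
  rw [hS, ← hi, lowSum_succ q i.isLt] at h2
  have h3 : q ⟨i.val, i.isLt⟩ = q i := rfl
  linarith

theorem le_of_notMem_of_sum_eq (hx : x ∈ (permutohedronSystem q K).solutions)
    {S : Finset (Fin (m + 1))} (hS : ∑ i ∈ S, x i = lowSum q S.card) {u i : Fin (m + 1)}
    (hu : u ∉ S) (hi : i.val = S.card) : q i ≤ x u := by
  have h1 := lowSum_card_le hx (insert u S)
  rw [Finset.card_insert_of_notMem hu, ← hi, lowSum_succ q i.isLt, Finset.sum_insert hu, hS,
    ← hi] at h1
  have h3 : q ⟨i.val, i.isLt⟩ = q i := rfl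
  linarith

/-- With 0-based indices, `x v ≤ q_{|S|-1} < q_{|T|} ≤ x u`. This strict inequality forces the tight
sets into a chain and fixes how they meet neighbours from `K`. -/
theorem lt_of_sum_eq_of_card_le (hq : StrictMono q)
    (hx : x ∈ (permutohedronSystem q K).solutions) {S T : Finset (Fin (m + 1))}
    (hS : ∑ i ∈ S, x i = lowSum q S.card) (hT : ∑ i ∈ T, x i = lowSum q T.card)
    (hST : S.card ≤ T.card) {v u : Fin (m + 1)} (hv : v ∈ S) (hu : u ∉ T) : x v < x u := by
  have h1 : 0 < S.card := Finset.card_pos.2 ⟨v, hv⟩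
  have h2 : T.card < m + 1 := by
    have := Finset.card_lt_univ_of_notMem hu
    rwa [Fintype.card_fin] at this
  have h3 := le_of_mem_of_sum_eq hx hS (i := ⟨S.card - 1, by omega⟩) hv (by simp; omega)
  have h4 := le_of_notMem_of_sum_eq hx hT (i := ⟨T.card, h2⟩) hu rfl
  exact (h3.trans_lt (hq (Fin.mk_lt_mk.2 (by omega)))).trans_le h4

theorem subset_of_sum_eq_of_card_le (hq : StrictMono q)
    (hx : x ∈ (permutohedronSystem q K).solutions) {S T : Finset (Fin (m + 1))}
    (hS : ∑ i ∈ S, x i = lowSum q S.card) (hT : ∑ i ∈ T, x i = lowSum q T.card)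
    (hST : S.card ≤ T.card) : S ⊆ T := by
  intro v hv
  by_contra hvT
  exact lt_irrefl _ (lt_of_sum_eq_of_card_le hq hx hS hT hST hv hvT)

theorem inl_mem_tight {S : Finset (Fin (m + 1))} :
    Sum.inl S ∈ (permutohedronSystem q K).tight x ↔
      (S.Nonempty ∧ S ≠ Finset.univ) ∧ ∑ i ∈ S, x i = lowSum q S.card := by
  rw [LinearSystem.mem_tight]
  simp [permutohedronSystem]

theorem inr_mem_tight {k : Fin m} :
    Sum.inr k ∈ (permutohedronSystem q K).tight x ↔ k ∈ K ∧ x k.castSucc = x k.succ := by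
  rw [LinearSystem.mem_tight]
  simp [permutohedronSystem, sub_eq_zero, eq_comm]

theorem isFaceDatum_tight (hq : StrictMono q) (hx : x ∈ (permutohedronSystem q K).solutions) :
    IsFaceDatum K ((permutohedronSystem q K).tight x).toLeft
      ((permutohedronSystem q K).tight x).toRight := by
  have hK := (mem_solutions_permutohedronSystem.1 hx).2.2
  refine ⟨⟨fun S hS => ?_, fun S hS => ?_, fun S hS T hT => ?_⟩, fun k hk => ?_,
    fun S hS k hk h => ?_, fun S hS k hk h => ?_⟩ <;>
    simp only [Finset.mem_toLeft, Finset.mem_toRight, inl_mem_tight, inr_mem_tight] at *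
  · exact hS.1.1
  · exact hS.1.2
  · rcases le_total S.card T.card with h | h
    · exact Or.inl (subset_of_sum_eq_of_card_le hq hx hS.2 hT.2 h)
    · exact Or.inr (subset_of_sum_eq_of_card_le hq hx hT.2 hS.2 h)
  · exact hk.1
  · by_contra hc
    exact (hK k hk).not_gt (lt_of_sum_eq_of_card_le hq hx hS.2 hS.2 le_rfl h hc)
  · by_contra hc
    exact (lt_of_sum_eq_of_card_le hq hx hS.2 hS.2 le_rfl h hc).ne hk.2

end Tight

/-! ## Averages over the blocks of a level function -/

section Average

variable {α : Type*} [Fintype α] [DecidableEq α]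

/-- The permutations preserving a function. -/
def fiberPerms (l : α → ℕ) : Finset (Equiv.Perm α) :=
  Finset.univ.filter fun g => ∀ v, l (g v) = l v

/-- The average of `f ∘ g` over the permutations `g` preserving `l`. -/
noncomputable def fiberAverage (l : α → ℕ) (f : α → ℝ) : α → ℝ :=
  ∑ g ∈ fiberPerms l, ((fiberPerms l).card : ℝ)⁻¹ • (f ∘ g)

theorem fiberPerms_nonempty (l : α → ℕ) : (fiberPerms l).Nonempty :=
  ⟨1, by simp [fiberPerms]⟩

theorem fiberPerms_card_inv_mul (l : α → ℕ) :
    ((fiberPerms l).card : ℝ) * ((fiberPerms l).card : ℝ)⁻¹ = 1 :=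
  mul_inv_cancel₀ (Nat.cast_ne_zero.2 (Finset.card_pos.2 (fiberPerms_nonempty l)).ne')

theorem fiberAverage_apply (l : α → ℕ) (f : α → ℝ) (v : α) :
    fiberAverage l f v = ((fiberPerms l).card : ℝ)⁻¹ * ∑ g ∈ fiberPerms l, f (g v) := by
  simp [fiberAverage, Finset.mul_sum]

theorem fiberAverage_mem {l : α → ℕ} {f : α → ℝ} {s : Set (α → ℝ)} (hs : Convex ℝ s)
    (h : ∀ g ∈ fiberPerms l, f ∘ g ∈ s) : fiberAverage l f ∈ s := by
  refine hs.sum_mem (fun _ _ => by positivity) ?_ h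
  rw [Finset.sum_const, nsmul_eq_mul, fiberPerms_card_inv_mul]

theorem fiberAverage_eq {l : α → ℕ} (f : α → ℝ) {u v : α} (huv : l u = l v) :
    fiberAverage l f u = fiberAverage l f v := by
  rw [fiberAverage_apply, fiberAverage_apply]
  congr 1
  have hswap : ∀ w, l (Equiv.swap u v w) = l w := by
    intro w
    rcases eq_or_ne w u with rfl | h1
    · rw [Equiv.swap_apply_left, huv]
    rcases eq_or_ne w v with rfl | h2
    · rw [Equiv.swap_apply_right, huv]
    · rw [Equiv.swap_apply_of_ne_of_ne h1 h2]
  have hmem : ∀ g ∈ fiberPerms l, g * Equiv.swap u v ∈ fiberPerms l := by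
    intro g hg
    rw [fiberPerms, Finset.mem_filter] at hg ⊢
    exact ⟨Finset.mem_univ _, fun w => by rw [Equiv.Perm.mul_apply, hg.2, hswap]⟩
  refine Finset.sum_nbij' (fun g => g * Equiv.swap u v) (fun g => g * Equiv.swap u v)
    hmem hmem ?_ ?_ ?_
  · intro g _; simp [mul_assoc]
  · intro g _; simp [mul_assoc]
  · intro g _; simp

theorem sum_fiberAverage {l : α → ℕ} (f : α → ℝ) {S : Finset α}
    (hS : ∀ u v, l u = l v → u ∈ S → v ∈ S) : ∑ v ∈ S, fiberAverage l f v = ∑ v ∈ S, f v := by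
  simp only [fiberAverage_apply]
  rw [← Finset.mul_sum, Finset.sum_comm]
  have h : ∀ g ∈ fiberPerms l, ∑ v ∈ S, f (g v) = ∑ v ∈ S, f v := by
    intro g hg
    have hg := (Finset.mem_filter.1 hg).2
    exact Finset.sum_equiv g
      (fun v => ⟨hS _ _ (hg v).symm, hS _ _ (hg v)⟩) fun _ _ => rfl
  rw [Finset.sum_congr rfl h, Finset.sum_const, nsmul_eq_mul, ← mul_assoc,
    mul_comm _ ((fiberPerms l).card : ℝ), fiberPerms_card_inv_mul, one_mul]

end Average

/-! ## Realization of face data -/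

theorem eq_filter_lt_card {n : ℕ} {T : Finset (Fin n)} (hT : ∀ i j, i ≤ j → j ∈ T → i ∈ T) :
    T = Finset.univ.filter fun i => i.val < T.card := by
  have h1 : T ⊆ Finset.univ.filter fun i => i.val < T.card := by
    intro i hi
    have : Finset.Iic i ⊆ T := fun j hj => hT j i (Finset.mem_Iic.1 hj) hi
    have := Finset.card_le_card this
    rw [Fin.card_Iic] at this
    simpa using this
  refine Finset.eq_of_subset_of_card_le h1 ?_
  rw [Fin.card_filter_val_lt]
  exact min_le_right _ _

section Realization

variable {m : ℕ} {q : Fin (m + 1) → ℝ} {K : Finset (Fin m)}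
  {C : Finset (Finset (Fin (m + 1)))}

/-- Sorting by level makes every member of `C` an initial segment of the word, so this vertex puts
the smallest entries of `q` on it. -/
theorem sum_comp_sort_level (hC : IsProperChain C) {S : Finset (Fin (m + 1))} (hS : S ∈ C) :
    ∑ v ∈ S, q ((Tuple.sort (level C))⁻¹ v) = lowSum q S.card := by
  set w := Tuple.sort (level C) with hw
  have hlow := eq_filter_lt_card (T := S.map (w⁻¹).toEmbedding) fun i j hij hj => by
    rw [Finset.mem_map_equiv] at hj ⊢
    exact hC.level_le_iff.1 (Tuple.monotone_sort (level C) hij) S hS hj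
  rw [Finset.card_map] at hlow
  rw [lowSum, ← hlow, Finset.sum_map]
  rfl

/-- The point of the permutohedron that is constant on the blocks of a chain. -/
noncomputable def blockCenter (q : Fin (m + 1) → ℝ) (C : Finset (Finset (Fin (m + 1)))) :
    Fin (m + 1) → ℝ :=
  fiberAverage (level C) fun v => q ((Tuple.sort (level C))⁻¹ v)

theorem blockCenter_mem (hq : Monotone q) : blockCenter q C ∈ (permutohedronSystem q ∅).solutions := by
  rw [← permutohedron_eq_solutions hq]
  refine fiberAverage_mem (convex_convexHull ℝ _) fun g _ => subset_convexHull ℝ _ ?_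
  exact ⟨(Tuple.sort (level C))⁻¹ * g, rfl⟩

theorem sum_blockCenter (hC : IsProperChain C) {S : Finset (Fin (m + 1))} (hS : S ∈ C) :
    ∑ v ∈ S, blockCenter q C v = lowSum q S.card := by
  rw [blockCenter, sum_fiberAverage, sum_comp_sort_level hC hS]
  exact fun u v huv => (hC.level_eq_iff.1 huv S hS).1

/-- A further tight set would be comparable with all members of `C`, hence would separate two points
of one block. Tightness makes their coordinates differ, while the block center is constant on
blocks. -/
theorem sum_blockCenter_eq_iff (hq : StrictMono q) (hC : IsProperChain C)
    {S : Finset (Fin (m + 1))} (h1 : S.Nonempty) (h2 : S ≠ Finset.univ) :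
    ∑ v ∈ S, blockCenter q C v = lowSum q S.card ↔ S ∈ C := by
  refine ⟨fun hS => ?_, sum_blockCenter hC⟩
  by_contra hSC
  have hz := blockCenter_mem (C := C) hq.monotone
  obtain ⟨v, hv, u, hu, h⟩ := hC.exists_separating h1 h2 fun T hT => by
    rcases le_total S.card T.card with h | h
    · exact Or.inl (subset_of_sum_eq_of_card_le hq hz hS (sum_blockCenter hC hT) h)
    · exact Or.inr (subset_of_sum_eq_of_card_le hq hz (sum_blockCenter hC hT) hS h)
  have hl : level C v = level C u := hC.level_eq_iff.2 fun T hT => h T hT fun hTS => hSC (hTS ▸ hT)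
  exact (lt_of_sum_eq_of_card_le hq hz hS hS le_rfl hv hu).ne (fiberAverage_eq _ hl)

/-- The block center is tight at `C` and at every `k ∈ K` lying inside a block. A perturbation with
zero block sums then loosens precisely those `k` outside `J`. -/
theorem exists_tight_eq (hq : StrictMono q) {J : Finset (Fin m)} (h : IsFaceDatum K C J) :
    ∃ x ∈ (permutohedronSystem q K).solutions,
      (permutohedronSystem q K).tight x = C.disjSum J := by
  have hC := h.chain
  have hz0 := blockCenter_mem (C := C) hq.monotone
  have hK : ∀ k ∈ K, level C k.castSucc ≤ level C k.succ := fun k hk =>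
    hC.level_le_iff.2 fun S hS => h.mem_of_succ_mem S hS k hk
  have hlt : ∀ k : Fin m, level C k.castSucc < level C k.succ →
      blockCenter q C k.castSucc < blockCenter q C k.succ := by
    intro k hk
    obtain ⟨S, hS, h1, h2⟩ := hC.level_lt_iff.1 hk
    exact lt_of_sum_eq_of_card_le hq hz0 (sum_blockCenter hC hS) (sum_blockCenter hC hS) le_rfl
      h1 h2
  have hz : blockCenter q C ∈ (permutohedronSystem q K).solutions := by
    rw [mem_solutions_permutohedronSystem] at hz0 ⊢
    refine ⟨hz0.1, hz0.2.1, fun k hk => ?_⟩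
    rcases (hK k hk).eq_or_lt with h1 | h1
    · exact (fiberAverage_eq _ h1).le
    · exact (hlt k h1).le
  have htl : ∀ S, Sum.inl S ∈ (permutohedronSystem q K).tight (blockCenter q C) ↔ S ∈ C := by
    intro S
    rw [inl_mem_tight]
    constructor
    · rintro ⟨⟨h1, h2⟩, h3⟩
      exact (sum_blockCenter_eq_iff hq hC h1 h2).1 h3
    · exact fun hS => ⟨⟨hC.nonempty S hS, hC.ne_univ S hS⟩, sum_blockCenter hC hS⟩
  have htr : ∀ k, Sum.inr k ∈ (permutohedronSystem q K).tight (blockCenter q C) ↔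
      k ∈ K ∧ level C k.castSucc = level C k.succ := by
    intro k
    rw [inr_mem_tight]
    refine and_congr_right fun hk => ⟨fun h1 => ?_, fun h1 => fiberAverage_eq _ h1⟩
    by_contra h2
    exact (hlt k (lt_of_le_of_ne (hK k hk) h2)).ne h1
  -- `y` jumps by one across each `k ∉ J` and is constant across each `k ∈ J`. Subtracting block
  -- averages below kills the block sums but keeps differences inside blocks.
  set y : Fin (m + 1) → ℝ := fun v => ∑ j : Fin m, if j.castSucc < v ∧ j ∉ J then 1 else 0 with hy
  have hyk : ∀ k : Fin m, y k.succ - y k.castSucc = if k ∈ J then 0 else 1 := by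
    intro k
    simp only [hy]
    rw [← Finset.sum_sub_distrib, Finset.sum_eq_single k]
    · by_cases hk : k ∈ J <;> simp [hk]
    · intro j _ hjk
      have : j.castSucc < k.succ ↔ j.castSucc < k.castSucc := by
        have : j.val ≠ k.val := fun h => hjk (Fin.ext h)
        simp only [Fin.lt_def, Fin.val_castSucc, Fin.val_succ]
        omega
      simp [this]
    · simp
  set v : Fin (m + 1) → ℝ := y - fiberAverage (level C) y with hv
  have hvS : ∀ S : Finset (Fin (m + 1)),
      (∀ a b, level C a = level C b → a ∈ S → b ∈ S) → ∑ i ∈ S, v i = 0 := by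
    intro S hS
    simp only [hv, Pi.sub_apply]
    rw [Finset.sum_sub_distrib, sum_fiberAverage y hS, sub_self]
  have hvk : ∀ k : Fin m, level C k.castSucc = level C k.succ →
      v k.succ - v k.castSucc = if k ∈ J then 0 else 1 := by
    intro k hk
    rw [← hyk k]
    simp only [hv, Pi.sub_apply, fiberAverage_eq y hk]
    ring
  have hil : ∀ S, (permutohedronSystem q K).ineq (Sum.inl S) v = ∑ i ∈ S, v i := by
    intro S; simp [permutohedronSystem]
  have hir : ∀ k, (permutohedronSystem q K).ineq (Sum.inr k) v = v k.succ - v k.castSucc := by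
    intro k; simp [permutohedronSystem]
  have hSC : ∀ S ∈ C, ∑ i ∈ S, v i = 0 := fun S hS =>
    hvS S fun a b hab => (hC.level_eq_iff.1 hab S hS).1
  obtain ⟨ε, -, hmem, ht⟩ := LinearSystem.exists_add_smul_mem (v := v) hz
    (by simpa [permutohedronSystem] using hvS Finset.univ (by simp)) (by
      rintro (S | k) hi
      · rw [hil, hSC S ((htl S).1 hi)]
      · rw [hir, hvk k ((htr k).1 hi).2]
        split_ifs <;> norm_num)
  refine ⟨_, hmem, ?_⟩
  ext (S | k)
  · rw [ht, htl, hil, Finset.inl_mem_disjSum]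
    exact ⟨fun h => h.1, fun hS => ⟨hS, hSC S hS⟩⟩
  · rw [ht, htr, hir, Finset.inr_mem_disjSum]
    constructor
    · rintro ⟨⟨_, h1⟩, h2⟩
      rw [hvk k h1] at h2
      by_contra hk
      simp [hk] at h2
    · intro hk
      have h1 : level C k.castSucc = level C k.succ := hC.level_eq_iff.2 fun S hS =>
        ⟨h.succ_mem S hS k hk, h.mem_of_succ_mem S hS k (h.subset hk)⟩
      exact ⟨⟨h.subset hk, h1⟩, by rw [hvk k h1, if_pos hk]⟩

end Realization

/-! ## Dimensions of faces -/

section Dimension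

variable {m : ℕ} {K : Finset (Fin m)} {C : Finset (Finset (Fin (m + 1)))} {J : Finset (Fin m)}

/-- The functionals that are constant on a face. -/
noncomputable def faceFunctional (C : Finset (Finset (Fin (m + 1)))) (J : Finset (Fin m)) :
    ↥(insert Finset.univ C) ⊕ ↥J → Module.Dual ℝ (Fin (m + 1) → ℝ) :=
  Sum.elim (fun S => ∑ i ∈ S.1, LinearMap.proj i)
    fun k => LinearMap.proj (R := ℝ) (φ := fun _ => ℝ) k.1.succ - LinearMap.proj k.1.castSucc

theorem faceFunctional_inl (S : ↥(insert Finset.univ C)) (x : Fin (m + 1) → ℝ) :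
    faceFunctional C J (Sum.inl S) x = ∑ i ∈ S.1, x i := by
  simp [faceFunctional]

theorem faceFunctional_inr (k : ↥J) (x : Fin (m + 1) → ℝ) :
    faceFunctional C J (Sum.inr k) x = x k.1.succ - x k.1.castSucc := by
  simp [faceFunctional]

/-- A relation is tested on `A = ∑ g_S 1_S`. This vector does not jump across `J`, so the relation
reads `∑ A_v² = 0`. Separating points then isolate each `g_S`, and indicators of initial segments
isolate the coefficients of `J`. -/
theorem linearIndependent_faceFunctional (h : IsFaceDatum K C J) :
    LinearIndependent ℝ (faceFunctional C J) := by
  have hC := h.chain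
  rw [Fintype.linearIndependent_iff]
  intro g hg
  have happ : ∀ x : Fin (m + 1) → ℝ,
      ∑ S, g (Sum.inl S) * ∑ i ∈ S.1, x i +
        ∑ k, g (Sum.inr k) * (x k.1.succ - x k.1.castSucc) = 0 := by
    intro x
    have := congrArg (fun f => f x) hg
    simpa [Fintype.sum_sum_type, faceFunctional_inl, faceFunctional_inr] using this
  set A : Fin (m + 1) → ℝ :=
    fun v => ∑ S : ↥(insert Finset.univ C), if v ∈ S.1 then g (Sum.inl S) else 0 with hA
  have hAJ : ∀ k ∈ J, A k.succ = A k.castSucc := by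
    intro k hk
    refine Finset.sum_congr rfl fun S _ => ?_
    have : k.succ ∈ S.1 ↔ k.castSucc ∈ S.1 := by
      rcases Finset.mem_insert.1 S.2 with hS | hS
      · simp [hS]
      · exact ⟨h.mem_of_succ_mem _ hS k (h.subset hk), h.succ_mem _ hS k hk⟩
    simp [this]
  have hA0 : ∀ v, A v = 0 := by
    have h1 := happ A
    rw [Finset.sum_eq_zero (s := Finset.univ) (f := fun k : ↥J => _) fun k _ => by
      rw [hAJ k.1 k.2, sub_self, mul_zero], add_zero] at h1
    have h2 : ∑ v, A v * A v = 0 := by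
      rw [← h1]
      simp only [Finset.mul_sum]
      have : ∀ v, A v * A v =
          ∑ S : ↥(insert Finset.univ C), if v ∈ S.1 then g (Sum.inl S) * A v else 0 := by
        intro v
        conv_lhs => enter [1]; rw [hA]
        simp only [Finset.sum_mul, ite_mul, zero_mul]
      simp only [this]
      rw [Finset.sum_comm]
      refine Finset.sum_congr rfl fun S _ => ?_
      rw [← Finset.sum_filter]
      exact Finset.sum_congr (by ext; simp) fun _ _ => rfl
    intro v
    have := (Finset.sum_eq_zero_iff_of_nonneg fun i _ => mul_self_nonneg (A i)).1 h2 v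
      (Finset.mem_univ v)
    exact mul_self_eq_zero.1 this
  have hgC : ∀ S : ↥(insert Finset.univ C), S.1 ∈ C → g (Sum.inl S) = 0 := by
    intro S hS
    obtain ⟨v, hv, u, hu, hsep⟩ := hC.exists_separating (hC.nonempty _ hS) (hC.ne_univ _ hS)
      fun T hT => hC.total _ hS T hT
    have h1 : A v - A u = g (Sum.inl S) := by
      simp only [hA]
      rw [← Finset.sum_sub_distrib, Finset.sum_eq_single S]
      · simp [hv, hu]
      · intro T _ hTS
        have : v ∈ T.1 ↔ u ∈ T.1 := by
          rcases Finset.mem_insert.1 T.2 with hT | hT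
          · simp [hT]
          · exact hsep T.1 hT fun h => hTS (Subtype.ext h)
        simp [this]
      · exact fun h => absurd (Finset.mem_univ S) h
    rw [← h1, hA0, hA0, sub_zero]
  have hgS : ∀ S, g (Sum.inl S) = 0 := by
    intro S
    rcases Finset.mem_insert.1 S.2 with hS | hS
    · have h1 := hA0 0
      simp only [hA] at h1
      rw [Finset.sum_eq_single S] at h1
      · simpa [hS] using h1
      · intro T _ hTS
        rcases Finset.mem_insert.1 T.2 with hT | hT
        · exact absurd (Subtype.ext (hT.trans hS.symm)) hTS
        · simp [hgC T hT]
      · exact fun h => absurd (Finset.mem_univ S) h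
    · exact hgC S hS
  rintro (S | k)
  · exact hgS S
  · have h1 := happ fun i => if i ≤ k.1.castSucc then 1 else 0
    simp only [hgS, zero_mul, Finset.sum_const_zero, zero_add] at h1
    rw [Finset.sum_eq_single k] at h1
    · simpa [Fin.le_def] using h1
    · intro j _ hjk
      have : j.1.succ ≤ k.1.castSucc ↔ j.1.castSucc ≤ k.1.castSucc := by
        have : j.1.val ≠ k.1.val := fun h => hjk (Subtype.ext (Fin.ext h))
        simp only [Fin.le_def, Fin.val_castSucc, Fin.val_succ]
        omega
      simp [this]
    · simp

/-- The equation acts as the extra set `univ`, which lowers the ambient dimension `m + 1` to `m`. -/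
theorem finrank_direction (q : Fin (m + 1) → ℝ) (h : IsFaceDatum K C J) :
    Module.finrank ℝ ((permutohedronSystem q K).direction (C.disjSum J)) + (C.card + J.card) =
      m := by
  have hdir : (permutohedronSystem q K).direction (C.disjSum J) =
      (Submodule.span ℝ (Set.range (faceFunctional C J))).dualCoannihilator := by
    ext v
    rw [LinearSystem.mem_direction, Submodule.mem_dualCoannihilator]
    have hl : ∀ S, (permutohedronSystem q K).ineq (Sum.inl S) v = ∑ i ∈ S, v i := by
      intro S; simp [permutohedronSystem]
    have hr : ∀ k, (permutohedronSystem q K).ineq (Sum.inr k) v = v k.succ - v k.castSucc := by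
      intro k; simp [permutohedronSystem]
    have h0 : (permutohedronSystem q K).eqn v = ∑ i, v i := by simp [permutohedronSystem]
    constructor
    · rintro ⟨h1, h2⟩
      have : Submodule.span ℝ (Set.range (faceFunctional C J)) ≤
          (Module.Dual.eval ℝ (Fin (m + 1) → ℝ) v).ker := by
        rw [Submodule.span_le]
        rintro _ ⟨S | k, rfl⟩
        · simp only [SetLike.mem_coe, LinearMap.mem_ker, Module.Dual.eval_apply,
            faceFunctional_inl]
          rcases Finset.mem_insert.1 S.2 with hS | hS
          · rw [hS, ← h0, h1]
          · rw [← hl]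
            exact h2 _ (Finset.inl_mem_disjSum.2 hS)
        · simp only [SetLike.mem_coe, LinearMap.mem_ker, Module.Dual.eval_apply,
            faceFunctional_inr]
          rw [← hr]
          exact h2 _ (Finset.inr_mem_disjSum.2 k.2)
      exact fun φ hφ => this hφ
    · intro h1
      refine ⟨?_, ?_⟩
      · have := h1 _ (Submodule.subset_span
          ⟨Sum.inl ⟨Finset.univ, Finset.mem_insert_self _ _⟩, rfl⟩)
        rwa [faceFunctional_inl, ← h0] at this
      · rintro (S | k) hi
        · have := h1 _ (Submodule.subset_span
            ⟨Sum.inl ⟨S, Finset.mem_insert_of_mem (Finset.inl_mem_disjSum.1 hi)⟩, rfl⟩)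
          rwa [faceFunctional_inl, ← hl] at this
        · have := h1 _ (Submodule.subset_span ⟨Sum.inr ⟨k, Finset.inr_mem_disjSum.1 hi⟩, rfl⟩)
          rwa [faceFunctional_inr, ← hr] at this
  have h1 := Subspace.finrank_add_finrank_dualCoannihilator_eq
    (Submodule.span ℝ (Set.range (faceFunctional C J)))
  have huniv : (Finset.univ : Finset (Fin (m + 1))) ∉ C := fun hu => h.chain.ne_univ _ hu rfl
  rw [finrank_span_eq_card (linearIndependent_faceFunctional h), ← hdir, Fintype.card_sum,
    Fintype.card_coe, Fintype.card_coe, Finset.card_insert_of_notMem huniv, Module.finrank_fin_fun] at h1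
  omega

end Dimension

/-! ## The `h`-polynomial of a partitioned permutohedron -/

open scoped Classical in
/-- All face data of the partitioned permutohedron. -/
noncomputable def faceData {m : ℕ} (K : Finset (Fin m)) :
    Finset (Finset (Finset (Fin (m + 1))) × Finset (Fin m)) :=
  Finset.univ.filter fun d => IsFaceDatum K d.1 d.2

theorem mem_faceData {m : ℕ} {K : Finset (Fin m)}
    {d : Finset (Finset (Fin (m + 1))) × Finset (Fin m)} :
    d ∈ faceData K ↔ IsFaceDatum K d.1 d.2 := by
  simp [faceData]

theorem hPolynomial_eq_sum_faceData {m : ℕ} {p : Fin (m + 1) → ℝ} (hp : Function.Injective p)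
    (K : Finset (Fin m)) :
    hPolynomial (partitionedPermutohedron p K) =
      ∑ d ∈ faceData K, (X - 1) ^ (m - (d.1.card + d.2.card)) := by
  set q := p ∘ Tuple.sort p with hqdef
  have hq : StrictMono q :=
    (Tuple.monotone_sort p).strictMono_of_injective (hp.comp (Equiv.injective _))
  have hP : partitionedPermutohedron p K = (permutohedronSystem q K).solutions := by
    rw [← partitionedPermutohedron_eq_solutions hq.monotone, partitionedPermutohedron,
      partitionedPermutohedron, hqdef, permutohedron_comp]
  rw [hP, LinearSystem.hPolynomial_solutions]
  symm
  refine Finset.sum_nbij' (fun d => d.1.disjSum d.2) (fun T => (T.toLeft, T.toRight)) ?_ ?_ ?_ ?_ ?_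
  · intro d hd
    exact LinearSystem.mem_tightSets.2 (exists_tight_eq hq (mem_faceData.1 hd))
  · intro T hT
    obtain ⟨x, hx, rfl⟩ := LinearSystem.mem_tightSets.1 hT
    exact mem_faceData.2 (isFaceDatum_tight hq hx)
  · intro d _; simp
  · intro T _; exact Finset.toLeft_disjSum_toRight
  · intro d hd
    have := finrank_direction q (mem_faceData.1 hd)
    congr 1
    omega

/-! ## Chains and positions in a word -/

section Words

variable {m : ℕ}

/-- The positions `i` such that `l` does not separate the letters number `i` and `i + 1`. -/
def uncut {α : Type*} [DecidableEq α] (l : Fin (m + 1) → α) (w : Equiv.Perm (Fin (m + 1))) :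
    Finset (Fin m) :=
  Finset.univ.filter fun i => l (w i.castSucc) = l (w i.succ)

theorem mem_uncut {α : Type*} [DecidableEq α] {l : Fin (m + 1) → α}
    {w : Equiv.Perm (Fin (m + 1))} {i : Fin m} :
    i ∈ uncut l w ↔ l (w i.castSucc) = l (w i.succ) := by
  simp [uncut]

/-- The set of the first letters of a word, up to position `i`. -/
def initialLetters (w : Equiv.Perm (Fin (m + 1))) (i : Fin m) : Finset (Fin (m + 1)) :=
  (Finset.Iic i.castSucc).map w.toEmbedding

theorem apply_mem_initialLetters {w : Equiv.Perm (Fin (m + 1))} {i : Fin m} {j : Fin (m + 1)} :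
    w j ∈ initialLetters w i ↔ j ≤ i.castSucc := by
  simp [initialLetters]

theorem initialLetters_injective (w : Equiv.Perm (Fin (m + 1))) :
    Function.Injective (initialLetters w) := by
  intro i j hij
  have h1 : i.castSucc ≤ j.castSucc := by
    rw [← apply_mem_initialLetters (w := w), ← hij, apply_mem_initialLetters]
  have h2 : j.castSucc ≤ i.castSucc := by
    rw [← apply_mem_initialLetters (w := w), hij, apply_mem_initialLetters]
  exact Fin.castSucc_injective _ (le_antisymm h1 h2)

theorem isProperChain_image_initialLetters (w : Equiv.Perm (Fin (m + 1))) (Q : Finset (Fin m)) :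
    IsProperChain (Q.image (initialLetters w)) := by
  refine ⟨fun S hS => ?_, fun S hS => ?_, fun S hS T hT => ?_⟩ <;>
    obtain ⟨i, hi, rfl⟩ := Finset.mem_image.1 hS
  · exact ⟨w i.castSucc, apply_mem_initialLetters.2 le_rfl⟩
  · intro h
    have : w i.succ ∈ initialLetters w i := h ▸ Finset.mem_univ _
    rw [apply_mem_initialLetters] at this
    simp [Fin.le_def] at this
  · obtain ⟨j, hj, rfl⟩ := Finset.mem_image.1 hT
    rcases le_total i j with h | h
    · exact Or.inl (Finset.map_subset_map.2
        (Finset.Iic_subset_Iic.2 (Fin.castSucc_le_castSucc_iff.2 h)))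
    · exact Or.inr (Finset.map_subset_map.2
        (Finset.Iic_subset_Iic.2 (Fin.castSucc_le_castSucc_iff.2 h)))

theorem monotone_level_image_initialLetters (w : Equiv.Perm (Fin (m + 1))) (Q : Finset (Fin m)) :
    Monotone (level (Q.image (initialLetters w)) ∘ w) := by
  intro a b hab
  refine (isProperChain_image_initialLetters w Q).level_le_iff.2 fun S hS hb => ?_
  obtain ⟨i, -, rfl⟩ := Finset.mem_image.1 hS
  exact apply_mem_initialLetters.2 (hab.trans (apply_mem_initialLetters.1 hb))

theorem uncut_level_image_initialLetters (w : Equiv.Perm (Fin (m + 1))) (Q : Finset (Fin m)) :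
    uncut (level (Q.image (initialLetters w))) w = Qᶜ := by
  ext i
  rw [mem_uncut, (isProperChain_image_initialLetters w Q).level_eq_iff, Finset.forall_mem_image,
    Finset.mem_compl]
  simp only [apply_mem_initialLetters]
  constructor
  · intro h hi
    simpa [Fin.le_def] using h hi
  · intro hi j hj
    have : j.val ≠ i.val := fun h => hi (Fin.ext h ▸ hj)
    simp only [Fin.le_def, Fin.val_castSucc, Fin.val_succ]
    omega

theorem IsProperChain.eq_initialLetters {C : Finset (Finset (Fin (m + 1)))}
    (hC : IsProperChain C) {w : Equiv.Perm (Fin (m + 1))} (hw : Monotone (level C ∘ w))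
    {S : Finset (Fin (m + 1))} (hS : S ∈ C) {i : Fin m} (h1 : w i.castSucc ∈ S)
    (h2 : w i.succ ∉ S) : S = initialLetters w i := by
  ext v
  obtain ⟨j, rfl⟩ := w.surjective v
  rw [apply_mem_initialLetters]
  constructor
  · intro hj
    by_contra hlt
    have hle : i.succ ≤ j := by
      simp only [Fin.le_def, Fin.val_castSucc, Fin.val_succ] at hlt ⊢
      omega
    exact h2 (hC.level_le_iff.1 (hw hle) S hS hj)
  · intro hle
    exact hC.level_le_iff.1 (hw hle) S hS h1

theorem IsProperChain.image_initialLetters_compl_uncut {C : Finset (Finset (Fin (m + 1)))}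
    (hC : IsProperChain C) {w : Equiv.Perm (Fin (m + 1))} (hw : Monotone (level C ∘ w)) :
    (uncut (level C) w)ᶜ.image (initialLetters w) = C := by
  ext S
  rw [Finset.mem_image]
  constructor
  · rintro ⟨i, hi, rfl⟩
    rw [Finset.mem_compl, mem_uncut] at hi
    have hlt : level C (w i.castSucc) < level C (w i.succ) :=
      lt_of_le_of_ne (hw i.castSucc_lt_succ.le) hi
    obtain ⟨S, hS, h1, h2⟩ := hC.level_lt_iff.1 hlt
    rwa [← hC.eq_initialLetters hw hS h1 h2]
  · intro hS
    obtain ⟨j, hj, hmax⟩ := (Finset.univ.filter fun j => w j ∈ S).exists_max_image id (by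
      obtain ⟨v, hv⟩ := hC.nonempty S hS
      exact ⟨w⁻¹ v, by simpa using hv⟩)
    simp only [Finset.mem_filter, Finset.mem_univ, true_and, id] at hj hmax
    induction j using Fin.lastCases with
    | last =>
      refine absurd (Finset.eq_univ_iff_forall.2 fun v => ?_) (hC.ne_univ S hS)
      obtain ⟨i, rfl⟩ := w.surjective v
      exact hC.level_le_iff.1 (hw (Fin.le_last i)) S hS hj
    | cast i =>
      have hn : w i.succ ∉ S := fun h => (hmax _ h).not_gt i.castSucc_lt_succ
      refine ⟨i, ?_, (hC.eq_initialLetters hw hS hj hn).symm⟩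
      rw [Finset.mem_compl, mem_uncut, hC.level_eq_iff]
      exact fun h => hn ((h S hS).1 hj)

theorem IsProperChain.card_uncut_add_card {C : Finset (Finset (Fin (m + 1)))}
    (hC : IsProperChain C) {w : Equiv.Perm (Fin (m + 1))} (hw : Monotone (level C ∘ w)) :
    (uncut (level C) w).card + C.card = m := by
  conv_lhs => rw [← hC.image_initialLetters_compl_uncut hw,
    Finset.card_image_of_injective _ (initialLetters_injective w),
    uncut_level_image_initialLetters, compl_compl, Finset.card_add_card_compl]
  exact Fintype.card_fin m

-- A chain compatible with `w` is a choice of cut positions: a cut after position `i` records the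
-- set of letters up to `i`.
open scoped Classical in
theorem sum_isProperChain_uncut {R : Type*} [AddCommMonoid R] (w : Equiv.Perm (Fin (m + 1)))
    (G : Finset (Fin m) → R) :
    ∑ C with IsProperChain C ∧ Monotone (level C ∘ w), G (uncut (level C) w) = ∑ U, G U := by
  refine Finset.sum_nbij' (fun C => uncut (level C) w) (fun U => Uᶜ.image (initialLetters w))
    ?_ ?_ ?_ ?_ ?_
  · intro C _; exact Finset.mem_univ _
  · intro U _
    exact Finset.mem_filter.2 ⟨Finset.mem_univ _, isProperChain_image_initialLetters w _,
      monotone_level_image_initialLetters w _⟩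
  · intro C hC
    obtain ⟨-, hC, hw⟩ := Finset.mem_filter.1 hC
    exact hC.image_initialLetters_compl_uncut hw
  · intro U _
    simp only [uncut_level_image_initialLetters, compl_compl]
  · intro C _; rfl

/-! ## Words that are unimodal on the blocks of a level function -/

/-- The elements that are not the smallest of their fiber. -/
def nonMinima {α : Type*} [DecidableEq α] (l : Fin (m + 1) → α) : Finset (Fin (m + 1)) :=
  Finset.univ.filter fun v => ∃ u < v, l u = l v

theorem mem_nonMinima {α : Type*} [DecidableEq α] {l : Fin (m + 1) → α} {v : Fin (m + 1)} :
    v ∈ nonMinima l ↔ ∃ u < v, l u = l v := by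
  simp [nonMinima]

theorem card_nonMinima_add {α : Type*} [DecidableEq α] (l : Fin (m + 1) → α) :
    (nonMinima l).card + (Finset.univ.image l).card = m + 1 := by
  have h : (Finset.univ.image l).card = (nonMinima l)ᶜ.card := by
    have himage : Finset.univ.image l = (nonMinima l)ᶜ.image l := by
      refine Finset.Subset.antisymm (fun a ha => ?_) (Finset.image_subset_image (Finset.subset_univ _))
      obtain ⟨v, -, rfl⟩ := Finset.mem_image.1 ha
      obtain ⟨u, hu, hmin⟩ := (Finset.univ.filter fun u => l u = l v).exists_min_image id
        ⟨v, by simp⟩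
      simp only [Finset.mem_filter, Finset.mem_univ, true_and, id] at hu hmin
      refine Finset.mem_image.2 ⟨u, ?_, hu⟩
      rw [Finset.mem_compl, mem_nonMinima]
      rintro ⟨t, ht, htu⟩
      exact (hmin t (htu.trans hu)).not_gt ht
    rw [himage]
    refine Finset.card_image_of_injOn fun u hu v hv huv => ?_
    rw [Finset.mem_coe, Finset.mem_compl, mem_nonMinima] at hu hv
    rcases lt_trichotomy u v with h | h | h
    · exact absurd ⟨u, h, huv⟩ hv
    · exact h
    · exact absurd ⟨v, h, huv.symm⟩ hu
  rw [h, Finset.card_add_card_compl, Fintype.card_fin]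

/-- Both numbers are `m + 1` minus the number of blocks. -/
theorem card_uncut_eq {l : Fin (m + 1) → ℕ} {w : Equiv.Perm (Fin (m + 1))}
    (hw : Monotone (l ∘ w)) : (uncut l w).card = (nonMinima l).card := by
  have h1 : nonMinima (l ∘ w) = (uncut l w).map (Fin.succEmb m) := by
    ext v
    rw [mem_nonMinima, Finset.mem_map]
    constructor
    · rintro ⟨u, huv, h⟩
      induction v using Fin.cases with
      | zero => exact absurd huv (Fin.not_lt_zero u)
      | succ i =>
        refine ⟨i, mem_uncut.2 (le_antisymm (hw i.castSucc_lt_succ.le) ?_), rfl⟩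
        have hui : u ≤ i.castSucc := Fin.le_castSucc_iff.2 huv
        exact h.ge.trans (hw hui)
    · rintro ⟨i, hi, rfl⟩
      exact ⟨i.castSucc, i.castSucc_lt_succ, mem_uncut.1 hi⟩
  have h2 := card_nonMinima_add l
  have h3 := card_nonMinima_add (l ∘ w)
  have h4 : Finset.univ.image (l ∘ w) = Finset.univ.image l := by
    rw [← Finset.image_image, Finset.image_univ_equiv]
  rw [h1, Finset.card_map, h4] at h3
  omega

/-- No two consecutive positions of `U` are an ascent followed by a descent. -/
def NoPeak (U D : Finset (Fin m)) : Prop :=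
  ∀ i j : Fin m, j.val = i.val + 1 → i ∈ U → j ∈ U → i ∉ D → j ∉ D

/-- The letters at the descents inside the blocks of `l`. -/
def descentLetters (l : Fin (m + 1) → ℕ) (w : Equiv.Perm (Fin (m + 1))) : Finset (Fin (m + 1)) :=
  (uncut l w ∩ descents w).map (Fin.castSuccEmb.trans w.toEmbedding)

/-- The order of the letters in which the blocks of `l` come one after the other, and each block
starts with its letters from `R`, in decreasing order. -/
def blockKey (l : Fin (m + 1) → ℕ) (R : Finset (Fin (m + 1))) (v : Fin (m + 1)) : ℕ ×ₗ ℤ :=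
  toLex (l v, if v ∈ R then -(v.val : ℤ) else v.val)

theorem mem_descents {w : Equiv.Perm (Fin (m + 1))} {i : Fin m} :
    i ∈ descents w ↔ w i.succ < w i.castSucc := by
  simp [descents]

theorem apply_mem_descentLetters {l : Fin (m + 1) → ℕ} {w : Equiv.Perm (Fin (m + 1))}
    {i : Fin m} : w i.castSucc ∈ descentLetters l w ↔ i ∈ uncut l w ∧ i ∈ descents w := by
  simp only [descentLetters, Finset.mem_map, Finset.mem_inter]
  constructor
  · rintro ⟨j, hj, h⟩
    have := Fin.castSucc_injective _ (w.injective h)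
    rwa [← this]
  · exact fun h => ⟨i, h, rfl⟩

theorem descentLetters_subset (l : Fin (m + 1) → ℕ) (w : Equiv.Perm (Fin (m + 1))) :
    descentLetters l w ⊆ nonMinima l := by
  intro v hv
  obtain ⟨i, hi, rfl⟩ := Finset.mem_map.1 hv
  obtain ⟨h1, h2⟩ := Finset.mem_inter.1 hi
  exact mem_nonMinima.2 ⟨w i.succ, mem_descents.1 h2, (mem_uncut.1 h1).symm⟩

theorem blockKey_lt {l : Fin (m + 1) → ℕ} {R : Finset (Fin (m + 1))} {u v : Fin (m + 1)} :
    blockKey l R u < blockKey l R v ↔ l u < l v ∨ l u = l v ∧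
      (if u ∈ R then -(u.val : ℤ) else u.val) < if v ∈ R then -(v.val : ℤ) else v.val :=
  Prod.Lex.toLex_lt_toLex

theorem blockKey_injective (l : Fin (m + 1) → ℕ) (R : Finset (Fin (m + 1))) :
    Function.Injective (blockKey l R) := by
  intro u v h
  have h : (l u, if u ∈ R then -(u.val : ℤ) else u.val) =
    (l v, if v ∈ R then -(v.val : ℤ) else v.val) := h
  have h2 := (Prod.ext_iff.1 h).2
  simp only at h2
  apply Fin.ext
  split_ifs at h2 <;> omega

/-- In a block without a peak all descents precede all ascents, so the descent letters come first,
in decreasing order. -/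
theorem strictMono_blockKey_descentLetters {l : Fin (m + 1) → ℕ} {w : Equiv.Perm (Fin (m + 1))}
    (h1 : Monotone (l ∘ w)) (h2 : NoPeak (uncut l w) (descents w)) :
    StrictMono (blockKey l (descentLetters l w) ∘ w) := by
  rw [Fin.strictMono_iff_lt_succ]
  intro i
  rw [Function.comp_apply, Function.comp_apply, blockKey_lt]
  rcases (h1 i.castSucc_lt_succ.le).lt_or_eq with h | h
  · exact Or.inl h
  refine Or.inr ⟨h, ?_⟩
  have hU : i ∈ uncut l w := mem_uncut.2 h
  by_cases hD : i ∈ descents w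
  · rw [if_pos (apply_mem_descentLetters.2 ⟨hU, hD⟩)]
    have := Fin.lt_def.1 (mem_descents.1 hD)
    split_ifs <;> omega
  · rw [if_neg fun h => hD (apply_mem_descentLetters.1 h).2]
    have hlt : w i.castSucc < w i.succ := by
      refine lt_of_le_of_ne (not_lt.1 fun h => hD (mem_descents.2 h)) fun h => ?_
      exact i.castSucc_lt_succ.ne (w.injective h)
    have hn : w i.succ ∉ descentLetters l w := by
      intro hmem
      obtain ⟨j, hj, hji⟩ := Finset.mem_map.1 hmem
      obtain ⟨hjU, hjD⟩ := Finset.mem_inter.1 hj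
      have hji : j.castSucc = i.succ := w.injective hji
      exact h2 i j (by simpa [Fin.ext_iff] using hji) hU hjU hD hjD
    rw [if_neg hn]
    exact_mod_cast hlt

/-- A letter of `R` is not minimal in its block, so a smaller letter of the block follows it and it
sits at a descent. A block minimum in `R` would not. -/
theorem of_strictMono_blockKey {l : Fin (m + 1) → ℕ} {w : Equiv.Perm (Fin (m + 1))}
    {R : Finset (Fin (m + 1))} (hR : R ⊆ nonMinima l) (h : StrictMono (blockKey l R ∘ w)) :
    Monotone (l ∘ w) ∧ NoPeak (uncut l w) (descents w) ∧ descentLetters l w = R := by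
  have hlt : ∀ {a b : Fin (m + 1)}, a < b → l (w a) < l (w b) ∨ l (w a) = l (w b) ∧
      (if w a ∈ R then -((w a).val : ℤ) else (w a).val) <
        if w b ∈ R then -((w b).val : ℤ) else (w b).val := fun hab => blockKey_lt.1 (h hab)
  have hmono : Monotone (l ∘ w) := by
    intro a b hab
    rcases hab.lt_or_eq with hab | rfl
    · rcases hlt hab with h | h
      · exact h.le
      · exact h.1.le
    · exact le_rfl
  have hdes : ∀ i : Fin m, i ∈ uncut l w → i ∈ descents w → w i.castSucc ∈ R := by
    intro i hU hD
    by_contra hn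
    have h1 := ((hlt i.castSucc_lt_succ).resolve_left (mem_uncut.1 hU).not_lt).2
    have h2 := Fin.lt_def.1 (mem_descents.1 hD)
    rw [if_neg hn] at h1
    split_ifs at h1 <;> omega
  refine ⟨hmono, fun i j hij hi hj hiD hjD => hiD ?_, Finset.Subset.antisymm ?_ ?_⟩
  · have hjR := hdes j hj hjD
    have hji : j.castSucc = i.succ := Fin.ext (by simpa using hij)
    have h1 := ((hlt i.castSucc_lt_succ).resolve_left (mem_uncut.1 hi).not_lt).2
    rw [← hji, if_pos hjR] at h1
    rw [mem_descents, Fin.lt_def, ← hji]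
    split_ifs at h1 <;> omega
  · intro v hv
    obtain ⟨i, hi, rfl⟩ := Finset.mem_map.1 hv
    exact hdes i (Finset.mem_inter.1 hi).1 (Finset.mem_inter.1 hi).2
  · intro v hv
    obtain ⟨u, huv, hl⟩ := mem_nonMinima.1 (hR hv)
    obtain ⟨a, rfl⟩ := w.surjective v
    obtain ⟨b, rfl⟩ := w.surjective u
    rw [Fin.lt_def] at huv
    have hab : a < b := by
      by_contra hab
      have hba : b < a := lt_of_le_of_ne (not_lt.1 hab) (by rintro rfl; exact lt_irrefl _ huv)
      have h1 := ((hlt hba).resolve_left hl.not_lt).2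
      rw [if_pos hv] at h1
      split_ifs at h1 <;> omega
    induction a using Fin.lastCases with
    | last => exact absurd hab (Fin.le_last b).not_gt
    | cast i =>
      have hib : i.succ ≤ b := by
        rw [Fin.lt_def] at hab
        simpa [Fin.le_def] using hab
      have hiU : l (w i.castSucc) = l (w i.succ) :=
        le_antisymm (hmono i.castSucc_lt_succ.le) ((hmono hib).trans hl.le)
      refine apply_mem_descentLetters.2 ⟨mem_uncut.2 hiU, mem_descents.2 ?_⟩
      rw [Fin.lt_def]
      by_contra hge
      have hne : (w i.castSucc).val ≠ (w i.succ).val := fun h =>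
        i.castSucc_lt_succ.ne (w.injective (Fin.ext h))
      have h1 := ((hlt i.castSucc_lt_succ).resolve_left hiU.not_lt).2
      rw [if_pos hv] at h1
      rcases hib.lt_or_eq with hib | rfl
      · have h2 := ((hlt hib).resolve_left (hiU.symm.trans hl.symm).not_lt).2
        split_ifs at h1 h2 <;> omega
      · omega

theorem strictMono_sort_blockKey (l : Fin (m + 1) → ℕ) (R : Finset (Fin (m + 1))) :
    StrictMono (blockKey l R ∘ Tuple.sort (blockKey l R)) :=
  (Tuple.monotone_sort _).strictMono_of_injective
    ((blockKey_injective l R).comp (Equiv.injective _))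

theorem eq_sort_blockKey {l : Fin (m + 1) → ℕ} {R : Finset (Fin (m + 1))}
    {w : Equiv.Perm (Fin (m + 1))} (h : StrictMono (blockKey l R ∘ w)) :
    Tuple.sort (blockKey l R) = w := by
  have := Tuple.unique_monotone (strictMono_sort_blockKey l R).monotone h.monotone
  ext i
  rw [blockKey_injective l R (congrFun this i)]

end Words

/-! ## Weighted sums over words -/

section WeightedSums

variable {m : ℕ}

/-- The smaller of any two neighbouring values `k`, `k + 1` with `k ∈ K` comes first in the word. -/
def RespectsOrder (K : Finset (Fin m)) (w : Equiv.Perm (Fin (m + 1))) : Prop :=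
  ∀ k ∈ K, w⁻¹ k.castSucc < w⁻¹ k.succ

/-- The weight of a word with descents `D` cut into pieces at the positions outside `U`. -/
noncomputable def cutWeight (U D : Finset (Fin m)) : ℤ[X] :=
  ∏ i ∈ U, if i ∈ D then -1 else X

/-- Inside a block the key of `k + 1` is `-(k + 1)` or `k + 1`, which lies below or above both
possible keys `±k` of `k`. -/
theorem respectsOrder_iff {K : Finset (Fin m)} {l : Fin (m + 1) → ℕ}
    {R : Finset (Fin (m + 1))} {w : Equiv.Perm (Fin (m + 1))}
    (h : StrictMono (blockKey l R ∘ w)) :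
    RespectsOrder K w ↔
      ∀ k ∈ K, l k.castSucc ≤ l k.succ ∧ (l k.castSucc = l k.succ → k.succ ∉ R) := by
  refine forall₂_congr fun k _ => ?_
  have h1 := h.lt_iff_lt (a := w⁻¹ k.castSucc) (b := w⁻¹ k.succ)
  have happly : ∀ a, w (w⁻¹ a) = a := w.apply_symm_apply
  simp only [Function.comp_apply, happly] at h1
  rw [← h1, blockKey_lt]
  have hval : (k.castSucc : Fin (m + 1)).val + 1 = k.succ.val := by simp
  constructor
  · rintro (h2 | ⟨h2, h3⟩)
    · exact ⟨h2.le, fun h => absurd h h2.ne⟩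
    · refine ⟨h2.le, fun _ hR => ?_⟩
      rw [if_pos hR] at h3
      split_ifs at h3 <;> omega
  · rintro ⟨h2, h3⟩
    rcases h2.lt_or_eq with h2 | h2
    · exact Or.inl h2
    · refine Or.inr ⟨h2, ?_⟩
      rw [if_neg (h3 h2)]
      split_ifs <;> omega

theorem cutWeight_uncut {l : Fin (m + 1) → ℕ} {w : Equiv.Perm (Fin (m + 1))}
    (hw : Monotone (l ∘ w)) :
    cutWeight (uncut l w) (descents w) = (-1) ^ (descentLetters l w).card *
      X ^ ((nonMinima l).card - (descentLetters l w).card) := by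
  rw [cutWeight, Finset.prod_ite, Finset.prod_const, Finset.prod_const, Finset.filter_mem_eq_inter]
  have h := Finset.card_filter_add_card_filter_not (s := uncut l w) (fun i => i ∈ descents w)
  rw [Finset.filter_mem_eq_inter, card_uncut_eq hw] at h
  have h2 : (descentLetters l w).card = (uncut l w ∩ descents w).card := Finset.card_map _
  rw [h2, ← h, Nat.add_sub_cancel_left]

-- Words correspond to their sets of descent letters; the inverse map sorts by `blockKey`.
open scoped Classical in
theorem sum_cutWeight_uncut (K : Finset (Fin m)) (l : Fin (m + 1) → ℕ) :
    ∑ w with RespectsOrder K w ∧ Monotone (l ∘ w) ∧ NoPeak (uncut l w) (descents w),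
        cutWeight (uncut l w) (descents w) =
      ∑ R ∈ (nonMinima l).powerset with
        ∀ k ∈ K, l k.castSucc ≤ l k.succ ∧ (l k.castSucc = l k.succ → k.succ ∉ R),
        (-1) ^ R.card * X ^ ((nonMinima l).card - R.card) := by
  refine Finset.sum_nbij' (fun w => descentLetters l w) (fun R => Tuple.sort (blockKey l R))
    ?_ ?_ ?_ ?_ ?_
  · intro w hw
    obtain ⟨-, h1, h2, h3⟩ := Finset.mem_filter.1 hw
    exact Finset.mem_filter.2 ⟨Finset.mem_powerset.2 (descentLetters_subset l w),
      (respectsOrder_iff (strictMono_blockKey_descentLetters h2 h3)).1 h1⟩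
  · intro R hR
    obtain ⟨h1, h2⟩ := Finset.mem_filter.1 hR
    obtain ⟨h3, h4, -⟩ := of_strictMono_blockKey (Finset.mem_powerset.1 h1)
      (strictMono_sort_blockKey l R)
    exact Finset.mem_filter.2 ⟨Finset.mem_univ _,
      (respectsOrder_iff (strictMono_sort_blockKey l R)).2 h2, h3, h4⟩
  · intro w hw
    obtain ⟨-, -, h2, h3⟩ := Finset.mem_filter.1 hw
    exact eq_sort_blockKey (strictMono_blockKey_descentLetters h2 h3)
  · intro R hR
    exact (of_strictMono_blockKey (Finset.mem_powerset.1 (Finset.mem_filter.1 hR).1)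
      (strictMono_sort_blockKey l R)).2.2
  · intro w hw
    exact cutWeight_uncut (Finset.mem_filter.1 hw).2.2.1

/-- The members of `K` whose two neighbours lie in the same block. -/
def blockNeighbours (K : Finset (Fin m)) (l : Fin (m + 1) → ℕ) : Finset (Fin m) :=
  K.filter fun k => l k.castSucc = l k.succ

theorem map_succ_blockNeighbours_subset (K : Finset (Fin m)) (l : Fin (m + 1) → ℕ) :
    (blockNeighbours K l).map (Fin.succEmb m) ⊆ nonMinima l := by
  intro v hv
  obtain ⟨k, hk, rfl⟩ := Finset.mem_map.1 hv
  exact mem_nonMinima.2 ⟨k.castSucc, k.castSucc_lt_succ, (Finset.mem_filter.1 hk).2⟩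

-- In the main case both sums are `X^|B| (X - 1)^(|M| - |B|)` with `B = blockNeighbours K l` and `M
-- = nonMinima l`: on the left `R` is free outside `|B|` forbidden letters, on the right `X = (X -
-- 1) + 1` is expanded.
open scoped Classical in
theorem sum_subsets_nonMinima (K : Finset (Fin m)) (l : Fin (m + 1) → ℕ) :
    ∑ R ∈ (nonMinima l).powerset with
        ∀ k ∈ K, l k.castSucc ≤ l k.succ ∧ (l k.castSucc = l k.succ → k.succ ∉ R),
        (-1) ^ R.card * (X : ℤ[X]) ^ ((nonMinima l).card - R.card) =
      if ∀ k ∈ K, l k.castSucc ≤ l k.succ then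
        ∑ J ∈ (blockNeighbours K l).powerset, (X - 1) ^ ((nonMinima l).card - J.card)
      else 0 := by
  split_ifs with hK
  · set E := (blockNeighbours K l).map (Fin.succEmb m) with hE
    have hEM : E ⊆ nonMinima l := map_succ_blockNeighbours_subset K l
    have hcard : (blockNeighbours K l).card + (nonMinima l \ E).card = (nonMinima l).card := by
      rw [Finset.card_sdiff_of_subset hEM, hE, Finset.card_map]
      have := Finset.card_le_card hEM
      rw [hE, Finset.card_map] at this
      omega
    have hset : ((nonMinima l).powerset.filter fun R => ∀ k ∈ K, l k.castSucc ≤ l k.succ ∧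
        (l k.castSucc = l k.succ → k.succ ∉ R)) = (nonMinima l \ E).powerset := by
      ext R
      simp only [Finset.mem_filter, Finset.mem_powerset, Finset.subset_sdiff]
      refine and_congr_right fun _ => ⟨fun h => Finset.disjoint_right.2 fun v hv => ?_,
        fun h k hk => ⟨hK k hk, fun hl hR => ?_⟩⟩
      · obtain ⟨k, hk, rfl⟩ := Finset.mem_map.1 hv
        obtain ⟨hk, hl⟩ := Finset.mem_filter.1 hk
        exact (h k hk).2 hl
      · exact Finset.disjoint_left.1 h hR
          (Finset.mem_map.2 ⟨k, Finset.mem_filter.2 ⟨hk, hl⟩, rfl⟩)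
    have h1 : ∀ R ∈ (nonMinima l \ E).powerset,
        (-1) ^ R.card * (X : ℤ[X]) ^ ((nonMinima l).card - R.card) =
          X ^ (blockNeighbours K l).card *
            ((-1) ^ R.card * X ^ ((nonMinima l \ E).card - R.card)) := by
      intro R hR
      have := Finset.card_le_card (Finset.mem_powerset.1 hR)
      rw [mul_left_comm, ← pow_add]
      congr 2
      omega
    have h2 : ∀ J ∈ (blockNeighbours K l).powerset,
        (X - 1 : ℤ[X]) ^ ((nonMinima l).card - J.card) =
          (1 ^ J.card * (X - 1) ^ ((blockNeighbours K l).card - J.card)) *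
            (X - 1) ^ (nonMinima l \ E).card := by
      intro J hJ
      have := Finset.card_le_card (Finset.mem_powerset.1 hJ)
      rw [one_pow, one_mul, ← pow_add]
      congr 1
      omega
    rw [hset, Finset.sum_congr rfl h1, ← Finset.mul_sum, Finset.sum_pow_mul_eq_add_pow,
      Finset.sum_congr rfl h2, ← Finset.sum_mul, Finset.sum_pow_mul_eq_add_pow]
    congr 2 <;> ring
  · refine Finset.sum_eq_zero fun R hR => absurd (fun k hk => ?_) hK
    exact ((Finset.mem_filter.1 hR).2 k hk).1

/-! ### From face data to words -/

theorem isFaceDatum_iff {K : Finset (Fin m)} {C : Finset (Finset (Fin (m + 1)))}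
    {J : Finset (Fin m)} : IsFaceDatum K C J ↔ IsProperChain C ∧
      (∀ k ∈ K, level C k.castSucc ≤ level C k.succ) ∧ J ⊆ blockNeighbours K (level C) := by
  constructor
  · intro h
    refine ⟨h.chain, fun k hk => h.chain.level_le_iff.2 fun S hS => h.mem_of_succ_mem S hS k hk,
      fun k hk => Finset.mem_filter.2 ⟨h.subset hk, h.chain.level_eq_iff.2 fun S hS => ?_⟩⟩
    exact ⟨h.succ_mem S hS k hk, h.mem_of_succ_mem S hS k (h.subset hk)⟩
  · rintro ⟨hC, h1, h2⟩
    refine ⟨hC, fun k hk => (Finset.mem_filter.1 (h2 hk)).1,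
      fun S hS k hk => hC.level_le_iff.1 (h1 k hk) S hS, fun S hS k hk => ?_⟩
    exact (hC.level_eq_iff.1 (Finset.mem_filter.1 (h2 hk)).2 S hS).1

open scoped Classical in
theorem sum_faceData_eq_sum_isProperChain (K : Finset (Fin m)) :
    ∑ d ∈ faceData K, (X - 1 : ℤ[X]) ^ (m - (d.1.card + d.2.card)) =
      ∑ C with IsProperChain C, if ∀ k ∈ K, level C k.castSucc ≤ level C k.succ then
        ∑ J ∈ (blockNeighbours K (level C)).powerset, (X - 1) ^ (m - (C.card + J.card)) else 0 := by
  rw [← Finset.sum_filter, Finset.sum_sigma']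
  refine Finset.sum_nbij' (fun d => ⟨d.1, d.2⟩) (fun d => (d.1, d.2)) ?_ ?_ ?_ ?_ ?_
  · intro d hd
    obtain ⟨h1, h2, h3⟩ := isFaceDatum_iff.1 (mem_faceData.1 hd)
    simp only [Finset.mem_sigma, Finset.mem_filter, Finset.mem_univ, true_and, Finset.mem_powerset]
    exact ⟨⟨h1, h2⟩, h3⟩
  · intro d hd
    simp only [Finset.mem_sigma, Finset.mem_filter, Finset.mem_univ, true_and,
      Finset.mem_powerset] at hd
    exact mem_faceData.2 (isFaceDatum_iff.2 ⟨hd.1.1, hd.1.2, hd.2⟩)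
  · intro d _; rfl
  · intro d _; rfl
  · intro d _; rfl

theorem IsProperChain.card_nonMinima {C : Finset (Finset (Fin (m + 1)))}
    (hC : IsProperChain C) : (nonMinima (level C)).card = m - C.card := by
  have h := Tuple.monotone_sort (level C)
  have h1 := hC.card_uncut_add_card h
  rw [card_uncut_eq h] at h1
  omega

open scoped Classical in
theorem sum_faceData_eq_sum_words (K : Finset (Fin m)) :
    ∑ d ∈ faceData K, (X - 1 : ℤ[X]) ^ (m - (d.1.card + d.2.card)) =
      ∑ w with RespectsOrder K w, ∑ U with NoPeak U (descents w), cutWeight U (descents w) := by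
  rw [sum_faceData_eq_sum_isProperChain]
  have h1 : ∀ C ∈ Finset.univ.filter fun C : Finset (Finset (Fin (m + 1))) => IsProperChain C,
      (if ∀ k ∈ K, level C k.castSucc ≤ level C k.succ then
        ∑ J ∈ (blockNeighbours K (level C)).powerset, (X - 1 : ℤ[X]) ^ (m - (C.card + J.card))
        else 0) = ∑ w with RespectsOrder K w, if Monotone (level C ∘ w) then
          (if NoPeak (uncut (level C) w) (descents w) then
            cutWeight (uncut (level C) w) (descents w) else 0) else 0 := by
    intro C hC
    rw [← Finset.sum_filter, ← Finset.sum_filter, Finset.filter_filter, Finset.filter_filter]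
    rw [sum_cutWeight_uncut, sum_subsets_nonMinima,
      (Finset.mem_filter.1 hC).2.card_nonMinima]
    simp only [Nat.sub_sub]
  rw [Finset.sum_congr rfl h1, Finset.sum_comm]
  refine Finset.sum_congr rfl fun w _ => ?_
  rw [← Finset.sum_filter, Finset.filter_filter]
  exact (sum_isProperChain_uncut w fun U =>
    if NoPeak U (descents w) then cutWeight U (descents w) else 0).trans
      (Finset.sum_filter _ _).symm

open scoped Classical in
/-- On every chain there is exactly one compatible word that is decreasing on the blocks. -/
theorem card_filter_uncut_subset_descents (l : Fin (m + 1) → ℕ) :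
    (Finset.univ.filter fun w : Equiv.Perm (Fin (m + 1)) =>
      Monotone (l ∘ w) ∧ uncut l w ⊆ descents w).card = 1 := by
  rw [Finset.card_eq_one]
  refine ⟨Tuple.sort (blockKey l (nonMinima l)), Finset.eq_singleton_iff_unique_mem.2
    ⟨?_, fun w hw => ?_⟩⟩
  · obtain ⟨h1, -, h3⟩ := of_strictMono_blockKey (Finset.Subset.refl _)
      (strictMono_sort_blockKey l (nonMinima l))
    refine Finset.mem_filter.2 ⟨Finset.mem_univ _, h1, ?_⟩
    rw [← Finset.inter_eq_left]
    refine Finset.eq_of_subset_of_card_le Finset.inter_subset_left ?_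
    rw [card_uncut_eq h1]
    conv_lhs => rw [← h3]
    exact (Finset.card_map _).le
  · obtain ⟨-, h1, h2⟩ := Finset.mem_filter.1 hw
    have h3 := strictMono_blockKey_descentLetters h1 fun i j _ hi _ hD => absurd (h2 hi) hD
    have h4 : descentLetters l w = nonMinima l := by
      refine Finset.eq_of_subset_of_card_le (descentLetters_subset l w) ?_
      rw [descentLetters, Finset.card_map, Finset.inter_eq_left.2 h2, card_uncut_eq h1]
    rw [h4] at h3
    exact (eq_sort_blockKey h3).symm

/-- Each chain contributes `(X - 1)^(m - |C|)`, charged to its unique compatible word decreasing on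
blocks. For a fixed word the uncut sets are then all subsets of its descent set, and their terms add
up to `X ^ des w`. -/
theorem sum_faceData_empty :
    ∑ d ∈ faceData (∅ : Finset (Fin m)), (X - 1 : ℤ[X]) ^ (m - (d.1.card + d.2.card)) =
      ∑ w : Equiv.Perm (Fin (m + 1)), X ^ des w := by
  classical
  rw [sum_faceData_eq_sum_isProperChain]
  have h1 : ∀ C ∈ Finset.univ.filter fun C : Finset (Finset (Fin (m + 1))) => IsProperChain C,
      (if ∀ k ∈ (∅ : Finset (Fin m)), level C k.castSucc ≤ level C k.succ then
        ∑ J ∈ (blockNeighbours ∅ (level C)).powerset, (X - 1 : ℤ[X]) ^ (m - (C.card + J.card))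
        else 0) = ∑ w : Equiv.Perm (Fin (m + 1)), if Monotone (level C ∘ w) then
          (if uncut (level C) w ⊆ descents w then (X - 1) ^ (uncut (level C) w).card else 0)
            else 0 := by
    intro C hC
    have hC := (Finset.mem_filter.1 hC).2
    have hcongr : ∀ w ∈ Finset.univ.filter fun w : Equiv.Perm (Fin (m + 1)) =>
        Monotone (level C ∘ w) ∧ uncut (level C) w ⊆ descents w,
        (X - 1 : ℤ[X]) ^ (uncut (level C) w).card = (X - 1) ^ (m - C.card) := by
      intro w hw
      rw [card_uncut_eq (Finset.mem_filter.1 hw).2.1, hC.card_nonMinima]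
    rw [← Finset.sum_filter, ← Finset.sum_filter, Finset.filter_filter,
      Finset.sum_congr rfl hcongr, Finset.sum_const, card_filter_uncut_subset_descents]
    simp [blockNeighbours]
  rw [Finset.sum_congr rfl h1, Finset.sum_comm]
  refine Finset.sum_congr rfl fun w _ => ?_
  rw [← Finset.sum_filter, Finset.filter_filter, sum_isProperChain_uncut w fun U =>
    if U ⊆ descents w then (X - 1 : ℤ[X]) ^ U.card else 0, ← Finset.sum_filter]
  have h2 : (Finset.univ.filter fun U => U ⊆ descents w) = (descents w).powerset := by
    ext U; simp
  have h3 := Finset.sum_pow_mul_eq_add_pow (X - 1 : ℤ[X]) 1 (descents w)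
  simp only [one_pow, mul_one, sub_add_cancel] at h3
  rw [h2, h3, des]

end WeightedSums

/-! ## The sum over all ways to cut a word -/

section Cuts

/-- No two consecutive members of `U` are an ascent followed by a descent. -/
def NatNoPeak (D : ℕ → Prop) (U : Finset ℕ) : Prop :=
  ∀ i ∈ U, i + 1 ∈ U → ¬ D i → ¬ D (i + 1)

/-- Every descent below `n` is preceded by an ascent. -/
def DescentsIsolated (D : ℕ → Prop) (n : ℕ) : Prop :=
  ∀ i < n, D i → ∃ j, i = j + 1 ∧ ¬ D j

open scoped Classical in
/-- The sum of the weights of all ways to cut a word with `n + 1` letters. -/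
noncomputable def cutSum (D : ℕ → Prop) (n : ℕ) : ℤ[X] :=
  ∑ U ∈ (Finset.range n).powerset,
    if NatNoPeak D U then ∏ i ∈ U, (if D i then -1 else X) else 0

variable {D : ℕ → Prop}

theorem natNoPeak_insert {n : ℕ} {U : Finset ℕ} (hU : U ⊆ Finset.range n) :
    NatNoPeak D (insert n U) ↔ NatNoPeak D U ∧ ∀ j ∈ U, n = j + 1 → ¬ D j → ¬ D n := by
  constructor
  · refine fun h => ⟨fun i hi hi' => h i (Finset.mem_insert_of_mem hi)
      (Finset.mem_insert_of_mem hi'), ?_⟩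
    rintro j hj rfl
    exact h j (Finset.mem_insert_of_mem hj) (Finset.mem_insert_self _ _)
  · rintro ⟨h1, h2⟩ i hi hi'
    have hlt : ∀ j ∈ U, j < n := fun j hj => Finset.mem_range.1 (hU hj)
    rcases Finset.mem_insert.1 hi with rfl | hiU
    · rcases Finset.mem_insert.1 hi' with h | h
      · omega
      · have := hlt _ h
        omega
    · rcases Finset.mem_insert.1 hi' with h | h
      · subst h
        exact h2 i hiU rfl
      · exact h1 i hiU h

open scoped Classical in
theorem cutSum_succ (n : ℕ) :
    cutSum D (n + 1) = cutSum D n + ∑ U ∈ (Finset.range n).powerset,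
      if NatNoPeak D U ∧ ∀ j ∈ U, n = j + 1 → ¬ D j → ¬ D n then
        (if D n then -1 else X) * ∏ i ∈ U, (if D i then -1 else X) else 0 := by
  rw [cutSum, Finset.range_add_one, Finset.sum_powerset_insert Finset.notMem_range_self, ← cutSum]
  congr 1
  refine Finset.sum_congr rfl fun U hU => ?_
  have hU := Finset.mem_powerset.1 hU
  simp only [natNoPeak_insert hU, Finset.prod_insert fun h => Finset.notMem_range_self (hU h)]

theorem cutSum_zero : cutSum D 0 = 1 := by
  simp [cutSum, NatNoPeak]

/-- An ascent never completes a peak: cutting there gives the factor `1`, not cutting gives `X`. -/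
theorem cutSum_succ_of_not {n : ℕ} (h : ¬ D n) : cutSum D (n + 1) = (1 + X) * cutSum D n := by
  classical
  rw [cutSum_succ, add_mul, one_mul]
  congr 1
  rw [cutSum, Finset.mul_sum]
  refine Finset.sum_congr rfl fun U _ => ?_
  rw [mul_ite, mul_zero, if_neg h]
  exact if_congr (and_iff_left fun _ _ _ _ => h) rfl rfl

/-- A descent with no ascent before it completes no peak either; cutting and not cutting differ by a
sign and cancel. -/
theorem cutSum_succ_of_isolated_fails {n : ℕ} (h : D n) (h' : ∀ j, n = j + 1 → D j) :
    cutSum D (n + 1) = 0 := by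
  classical
  rw [cutSum_succ]
  rw [cutSum, ← Finset.sum_add_distrib]
  refine Finset.sum_eq_zero fun U _ => ?_
  have h1 : (NatNoPeak D U ∧ ∀ j ∈ U, n = j + 1 → ¬ D j → ¬ D n) ↔ NatNoPeak D U :=
    and_iff_left fun j _ hn hj => absurd (h' j hn) hj
  rw [if_congr h1 rfl rfl, if_pos h]
  split_ifs <;> simp

/-- Cutting at the descent leaves `(1 + X) * cutSum D n`. Not cutting there forces a cut at the
preceding ascent and contributes `-cutSum D n`. -/
theorem cutSum_add_two {n : ℕ} (h : D (n + 1)) (h' : ¬ D n) :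
    cutSum D (n + 2) = X * cutSum D n := by
  classical
  rw [cutSum_succ, cutSum_succ_of_not h', Finset.range_add_one,
    Finset.sum_powerset_insert Finset.notMem_range_self]
  have h1 : ∀ U ∈ (Finset.range n).powerset,
      (if NatNoPeak D (insert n U) ∧ ∀ j ∈ insert n U, n + 1 = j + 1 → ¬ D j → ¬ D (n + 1) then
        (if D (n + 1) then -1 else X) * ∏ i ∈ insert n U, (if D i then (-1 : ℤ[X]) else X)
          else 0) = 0 := by
    intro U _
    rw [if_neg]
    exact fun hc => hc.2 n (Finset.mem_insert_self _ _) rfl h' h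
  have h2 : ∀ U ∈ (Finset.range n).powerset,
      (if NatNoPeak D U ∧ ∀ j ∈ U, n + 1 = j + 1 → ¬ D j → ¬ D (n + 1) then
        (if D (n + 1) then -1 else X) * ∏ i ∈ U, (if D i then (-1 : ℤ[X]) else X) else 0) =
      -if NatNoPeak D U then ∏ i ∈ U, (if D i then (-1 : ℤ[X]) else X) else 0 := by
    intro U hU
    have h3 : (NatNoPeak D U ∧ ∀ j ∈ U, n + 1 = j + 1 → ¬ D j → ¬ D (n + 1)) ↔
        NatNoPeak D U := by
      refine and_iff_left fun j hj hn => ?_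
      have := Finset.mem_range.1 (Finset.mem_powerset.1 hU hj)
      omega
    rw [if_congr h3 rfl rfl, if_pos h]
    split_ifs <;> simp
  rw [Finset.sum_congr rfl h1, Finset.sum_congr rfl h2, Finset.sum_neg_distrib, ← cutSum]
  simp
  ring

theorem cutSum_eq_zero {n : ℕ} (h : ¬ DescentsIsolated D n) : cutSum D n = 0 := by
  induction n using Nat.twoStepInduction with
  | zero => exact absurd (fun i hi => absurd hi (Nat.not_lt_zero i)) h
  | one =>
    refine cutSum_succ_of_isolated_fails ?_ fun j hj => absurd hj (by omega)
    by_contra h0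
    exact h fun i hi hD => absurd ((Nat.lt_one_iff.1 hi) ▸ hD) h0
  | more n ih1 ih2 =>
    by_cases h1 : D (n + 1)
    · by_cases h2 : D n
      · exact cutSum_succ_of_isolated_fails h1 fun j hj => (by omega : n = j) ▸ h2
      · rw [cutSum_add_two h1 h2, ih1, mul_zero]
        refine fun hc => h fun i hi hD => ?_
        by_cases hi1 : i < n
        · exact hc i hi1 hD
        · rcases (by omega : i = n ∨ i = n + 1) with rfl | rfl
          · exact absurd hD h2
          · exact ⟨n, rfl, h2⟩
    · rw [cutSum_succ_of_not h1, ih2, mul_zero]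
      refine fun hc => h fun i hi hD => ?_
      by_cases hi1 : i < n + 1
      · exact hc i hi1 hD
      · exact absurd ((by omega : i = n + 1) ▸ hD) h1

open scoped Classical in
theorem two_mul_card_le_and_cutSum_eq {n : ℕ} (h : DescentsIsolated D n) :
    2 * ((Finset.range n).filter D).card ≤ n ∧ cutSum D n =
      X ^ ((Finset.range n).filter D).card *
        (1 + X) ^ (n - 2 * ((Finset.range n).filter D).card) := by
  induction n using Nat.twoStepInduction with
  | zero => simp [cutSum_zero]
  | one =>
    have h0 : ¬ D 0 := fun hD => by
      obtain ⟨j, hj, -⟩ := h 0 Nat.one_pos hD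
      omega
    rw [cutSum_succ_of_not h0, cutSum_zero, Finset.range_one, Finset.filter_singleton, if_neg h0]
    simp
  | more n ih1 ih2 =>
    by_cases h1 : D (n + 1)
    · obtain ⟨j, hj, hDj⟩ := h (n + 1) (by omega) h1
      obtain rfl : n = j := by omega
      obtain ⟨h3, h4⟩ := ih1 fun i hi => h i (by omega)
      rw [cutSum_add_two h1 hDj, h4, Finset.range_add_one, Finset.filter_insert, if_pos h1,
        Finset.range_add_one, Finset.filter_insert, if_neg hDj,
        Finset.card_insert_of_notMem (by simp)]
      refine ⟨by omega, ?_⟩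
      rw [← mul_assoc, ← pow_succ']
      congr 2
      omega
    · obtain ⟨h3, h4⟩ := ih2 fun i hi => h i (by omega)
      rw [cutSum_succ_of_not h1, h4, Finset.range_add_one (n := n + 1), Finset.filter_insert,
        if_neg h1]
      refine ⟨by omega, ?_⟩
      rw [mul_left_comm, ← pow_succ']
      congr 2
      omega

/-! ### Application to the descents of a word -/

variable {m : ℕ}

open scoped Classical in
theorem sum_cutWeight_eq_cutSum (D : Finset (Fin m)) :
    ∑ U with NoPeak U D, cutWeight U D = cutSum (fun i => ∃ h : i < m, ⟨i, h⟩ ∈ D) m := by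
  rw [cutSum, Finset.sum_filter]
  have hmem : ∀ (U : Finset (Fin m)) (i : ℕ),
      i ∈ U.map Fin.valEmbedding ↔ ∃ h : i < m, ⟨i, h⟩ ∈ U := by
    intro U i
    simp only [Finset.mem_map, Fin.valEmbedding_apply]
    exact ⟨fun ⟨a, ha, h⟩ => ⟨h ▸ a.isLt, by subst h; exact ha⟩, fun ⟨h, ha⟩ => ⟨_, ha, rfl⟩⟩
  refine Finset.sum_bij (fun U _ => U.map Fin.valEmbedding) ?_ ?_ ?_ ?_
  · intro U _
    rw [Finset.mem_powerset]
    intro i hi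
    exact Finset.mem_range.2 ((hmem U i).1 hi).1
  · intro U _ V _ h
    exact Finset.map_injective _ h
  · intro T hT
    refine ⟨Finset.univ.filter fun i => i.val ∈ T, Finset.mem_univ _, ?_⟩
    ext i
    rw [hmem]
    simp only [Finset.mem_filter, Finset.mem_univ, true_and, exists_prop, and_iff_right_iff_imp]
    exact fun hi => Finset.mem_range.1 (Finset.mem_powerset.1 hT hi)
  · intro U _
    have h1 : NoPeak U D ↔
        NatNoPeak (fun i => ∃ h : i < m, ⟨i, h⟩ ∈ D) (U.map Fin.valEmbedding) := by
      constructor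
      · intro h i hi hi' hD
        obtain ⟨a, ha⟩ := (hmem U i).1 hi
        obtain ⟨b, hb⟩ := (hmem U _).1 hi'
        rintro ⟨_, hc⟩
        exact h ⟨i, a⟩ ⟨i + 1, b⟩ rfl ha hb (fun h => hD ⟨a, h⟩) hc
      · rintro h ⟨i, a⟩ ⟨j, b⟩ hij hi hj hD hjD
        obtain rfl : j = i + 1 := hij
        exact h i ((hmem U i).2 ⟨a, hi⟩) ((hmem U _).2 ⟨b, hj⟩) (fun ⟨_, h⟩ => hD h) ⟨b, hjD⟩
    simp only [← h1, cutWeight, Finset.prod_map, Fin.valEmbedding_apply, Fin.is_lt, exists_true_left,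
      Fin.eta]

theorem card_filter_exists_mem (D : Finset (Fin m))
    [DecidablePred fun i => ∃ h : i < m, ⟨i, h⟩ ∈ D] :
    ((Finset.range m).filter fun i => ∃ h : i < m, ⟨i, h⟩ ∈ D).card = D.card := by
  rw [← Finset.card_map Fin.valEmbedding]
  congr 1
  ext i
  simp only [Finset.mem_filter, Finset.mem_range, Finset.mem_map, Fin.valEmbedding_apply]
  exact ⟨fun ⟨_, h, hi⟩ => ⟨_, hi, rfl⟩, fun ⟨a, ha, h⟩ => by subst h; exact ⟨a.isLt, a.isLt, ha⟩⟩

theorem descentsIsolated_descents_iff (w : Equiv.Perm (Fin (m + 1))) :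
    DescentsIsolated (fun i => ∃ h : i < m, ⟨i, h⟩ ∈ descents w) m ↔
      ¬ HasDoubleDescent w ∧ ¬ HasInitialDescent w := by
  constructor
  · intro h
    refine ⟨?_, ?_⟩
    · rintro ⟨i, hi, j, hj, hij⟩
      obtain ⟨a, ha, hna⟩ := h j j.isLt ⟨j.isLt, hj⟩
      obtain rfl : a = i.val := by omega
      exact hna ⟨i.isLt, hi⟩
    · rintro ⟨i, hi, h0⟩
      obtain ⟨a, ha, -⟩ := h i i.isLt ⟨i.isLt, hi⟩
      omega
  · rintro ⟨h1, h2⟩ i hi ⟨_, hD⟩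
    rcases i with - | j
    · exact absurd ⟨_, hD, rfl⟩ h2
    · exact ⟨j, rfl, fun ⟨hj, hDj⟩ => h1 ⟨_, hDj, _, hD, rfl⟩⟩

theorem two_mul_des_le {w : Equiv.Perm (Fin (m + 1))} (h1 : ¬ HasDoubleDescent w)
    (h2 : ¬ HasInitialDescent w) : 2 * des w ≤ m := by
  have := (two_mul_card_le_and_cutSum_eq ((descentsIsolated_descents_iff w).2 ⟨h1, h2⟩)).1
  rwa [card_filter_exists_mem] at this

open scoped Classical in
theorem sum_faceData_eq_sum_isolated (K : Finset (Fin m)) :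
    ∑ d ∈ faceData K, (X - 1 : ℤ[X]) ^ (m - (d.1.card + d.2.card)) =
      ∑ w with RespectsOrder K w ∧ ¬ HasDoubleDescent w ∧ ¬ HasInitialDescent w,
        X ^ des w * (1 + X) ^ (m - 2 * des w) := by
  rw [sum_faceData_eq_sum_words, ← Finset.filter_filter, Finset.sum_filter (s := Finset.filter _ _)]
  refine Finset.sum_congr rfl fun w _ => ?_
  rw [sum_cutWeight_eq_cutSum]
  split_ifs with h
  · rw [(two_mul_card_le_and_cutSum_eq ((descentsIsolated_descents_iff w).2 h)).2,
      card_filter_exists_mem, des]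
  · exact cutSum_eq_zero fun hc => h ((descentsIsolated_descents_iff w).1 hc)

end Cuts

/-! ## Lengths and minimal coset representatives -/

section Length

variable {m : ℕ}

/-- The pairs of values of a word that are not in their natural order. -/
def inversions (w : Equiv.Perm (Fin (m + 1))) : Finset (Fin (m + 1) × Fin (m + 1)) :=
  Finset.univ.filter fun x => x.1 < x.2 ∧ w⁻¹ x.2 < w⁻¹ x.1

theorem mem_inversions {w : Equiv.Perm (Fin (m + 1))} {a b : Fin (m + 1)} :
    (a, b) ∈ inversions w ↔ a < b ∧ w⁻¹ b < w⁻¹ a := by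
  simp [inversions]

theorem inversions_one : inversions (1 : Equiv.Perm (Fin (m + 1))) = ∅ := by
  ext ⟨a, b⟩
  rw [mem_inversions]
  simp only [inv_one, Equiv.Perm.coe_one, id, Finset.notMem_empty, iff_false, not_and, not_lt]
  exact fun h => h.le

theorem adjTransposition_mul_self (k : Fin m) : adjTransposition k * adjTransposition k = 1 :=
  Equiv.swap_mul_self _ _

theorem adjTransposition_inv (k : Fin m) : (adjTransposition k)⁻¹ = adjTransposition k :=
  Equiv.swap_inv _ _

theorem adjTransposition_lt_iff (k : Fin m) {a b : Fin (m + 1)}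
    (h1 : ¬ (a = k.castSucc ∧ b = k.succ)) (h2 : ¬ (a = k.succ ∧ b = k.castSucc)) :
    adjTransposition k a < adjTransposition k b ↔ a < b := by
  simp only [adjTransposition, Equiv.swap_apply_def]
  simp only [Fin.ext_iff, Fin.val_castSucc, Fin.val_succ] at h1 h2
  split_ifs with h3 h4 h4 h5 h5 h6 h6 <;>
    simp only [Fin.ext_iff, Fin.lt_def, Fin.val_castSucc, Fin.val_succ] at * <;> omega

/-- Exchanging the values `k` and `k + 1` preserves the order of every other pair of values, so
inversions are carried along and only this pair is new. -/
theorem card_inversions_adjTransposition_mul {w : Equiv.Perm (Fin (m + 1))} {k : Fin m}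
    (hk : w⁻¹ k.castSucc < w⁻¹ k.succ) :
    (inversions (adjTransposition k * w)).card = (inversions w).card + 1 := by
  set s := adjTransposition k with hs
  have hsl : s k.castSucc = k.succ := Equiv.swap_apply_left _ _
  have hsr : s k.succ = k.castSucc := Equiv.swap_apply_right _ _
  have hinv : ∀ a, (s * w)⁻¹ a = w⁻¹ (s a) := fun a => by
    rw [mul_inv_rev, Equiv.Perm.mul_apply, hs, adjTransposition_inv]
  have hne : (k.castSucc, k.succ) ∉ (inversions w).map (s.prodCongr s).toEmbedding := by
    rw [Finset.mem_map_equiv]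
    change (s⁻¹ k.castSucc, s⁻¹ k.succ) ∉ inversions w
    rw [hs, adjTransposition_inv, ← hs, hsl, hsr, mem_inversions]
    exact fun h => h.1.not_gt k.castSucc_lt_succ
  have hset : inversions (s * w) =
      insert (k.castSucc, k.succ) ((inversions w).map (s.prodCongr s).toEmbedding) := by
    ext ⟨a, b⟩
    rw [Finset.mem_insert, Finset.mem_map_equiv]
    change _ ↔ _ ∨ (s⁻¹ a, s⁻¹ b) ∈ inversions w
    rw [hs, adjTransposition_inv, ← hs, mem_inversions, mem_inversions, hinv, hinv, Prod.ext_iff]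
    by_cases h1 : a = k.castSucc ∧ b = k.succ
    · rw [h1.1, h1.2, hsl, hsr]
      exact iff_of_true ⟨k.castSucc_lt_succ, hk⟩ (Or.inl ⟨rfl, rfl⟩)
    by_cases h2 : a = k.succ ∧ b = k.castSucc
    · rw [h2.1, h2.2, hsl, hsr]
      simp only [hk.not_gt, k.castSucc_lt_succ.not_gt, and_false, or_false, false_iff]
      exact fun h => k.castSucc_lt_succ.ne' h.1
    · rw [hs, adjTransposition_lt_iff k h1 h2]
      simp [h1]
  rw [hset, Finset.card_insert_of_notMem hne, Finset.card_map]

theorem card_inversions_adjTransposition_mul_of_gt {w : Equiv.Perm (Fin (m + 1))} {k : Fin m}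
    (hk : w⁻¹ k.succ < w⁻¹ k.castSucc) :
    (inversions w).card = (inversions (adjTransposition k * w)).card + 1 := by
  have h := card_inversions_adjTransposition_mul (w := adjTransposition k * w) (k := k) (by
    rw [mul_inv_rev, adjTransposition_inv, Equiv.Perm.mul_apply, Equiv.Perm.mul_apply,
      adjTransposition, Equiv.swap_apply_left, Equiv.swap_apply_right]
    exact hk)
  rwa [← mul_assoc, adjTransposition_mul_self, one_mul] at h

theorem inv_apply_lt_or_gt (w : Equiv.Perm (Fin (m + 1))) (k : Fin m) :
    w⁻¹ k.castSucc < w⁻¹ k.succ ∨ w⁻¹ k.succ < w⁻¹ k.castSucc :=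
  lt_or_gt_of_ne fun h => k.castSucc_lt_succ.ne ((w⁻¹).injective h)

theorem card_inversions_prod_le (l : List (Fin m)) :
    (inversions (l.map adjTransposition).prod).card ≤ l.length := by
  induction l with
  | nil => simp [inversions_one]
  | cons k l ih =>
    rw [List.map_cons, List.prod_cons, List.length_cons]
    rcases inv_apply_lt_or_gt (l.map adjTransposition).prod k with h | h
    · rw [card_inversions_adjTransposition_mul h]
      omega
    · have := card_inversions_adjTransposition_mul_of_gt h
      omega

/-- If there is any inversion, two neighbouring values are inverted, and exchanging them lowers the
count by one. -/
theorem exists_word_length_eq_card_inversions (w : Equiv.Perm (Fin (m + 1))) :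
    ∃ l : List (Fin m), (l.map adjTransposition).prod = w ∧ l.length = (inversions w).card := by
  induction h : (inversions w).card generalizing w with
  | zero =>
    refine ⟨[], ?_, rfl⟩
    have hmono : StrictMono (w⁻¹ : Equiv.Perm _) := by
      rw [Fin.strictMono_iff_lt_succ]
      intro k
      refine (inv_apply_lt_or_gt w k).resolve_right fun hk => ?_
      have := card_inversions_adjTransposition_mul_of_gt hk
      omega
    have hid : (⇑(w⁻¹) : Fin (m + 1) → Fin (m + 1)) = id :=
      (hmono.range_inj strictMono_id).1 (by rw [(w⁻¹).surjective.range_eq, Set.range_id])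
    have h1 : w⁻¹ = 1 := Equiv.ext fun a => congrFun hid a
    rw [List.map_nil, List.prod_nil, ← inv_inv w, h1, inv_one]
  | succ n ih =>
    obtain ⟨k, hk⟩ : ∃ k : Fin m, w⁻¹ k.succ < w⁻¹ k.castSucc := by
      by_contra! hcon
      have hmono : Monotone (w⁻¹ : Equiv.Perm _) := Fin.monotone_iff_le_succ.2 hcon
      obtain ⟨⟨a, b⟩, hab⟩ := Finset.card_pos.1 (h.symm ▸ Nat.succ_pos n : 0 < (inversions w).card)
      rw [mem_inversions] at hab
      exact hab.2.not_ge (hmono hab.1.le)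
    have hcard := card_inversions_adjTransposition_mul_of_gt hk
    obtain ⟨l, hl, hlen⟩ := ih (adjTransposition k * w) (by omega)
    refine ⟨k :: l, ?_, by rw [List.length_cons, hlen]⟩
    rw [List.map_cons, List.prod_cons, hl, ← mul_assoc, adjTransposition_mul_self, one_mul]

theorem permLength_eq_card_inversions (w : Equiv.Perm (Fin (m + 1))) :
    permLength w = (inversions w).card := by
  obtain ⟨l, hl, hlen⟩ := exists_word_length_eq_card_inversions w
  apply le_antisymm
  · exact Nat.sInf_le ⟨l, hl, hlen⟩
  · refine le_csInf ⟨_, l, hl, rfl⟩ ?_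
    rintro r ⟨l', rfl, rfl⟩
    exact card_inversions_prod_le l'

/-- No generator moves a value across the gap after `c`. -/
theorem le_castSucc_iff_of_mem_parabolic {K : Set (Fin m)} {u : Equiv.Perm (Fin (m + 1))}
    (hu : u ∈ parabolic K) {c : Fin m} (hc : c ∉ K) (a : Fin (m + 1)) :
    u a ≤ c.castSucc ↔ a ≤ c.castSucc := by
  induction hu using Subgroup.closure_induction generalizing a with
  | mem x hx =>
    obtain ⟨k, hk, rfl⟩ := hx
    have : k.val ≠ c.val := fun h => hc (Fin.ext h ▸ hk)
    simp only [adjTransposition, Equiv.swap_apply_def]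
    split_ifs with h1 h2
    · rw [h1]
      simp only [Fin.le_def, Fin.val_castSucc, Fin.val_succ]
      omega
    · rw [h2]
      simp only [Fin.le_def, Fin.val_castSucc, Fin.val_succ]
      omega
    · rfl
  | one => rfl
  | mul x y _ _ hx hy => rw [Equiv.Perm.mul_apply, hx, hy]
  | inv x _ hx => rw [← hx]; exact iff_of_eq (congrArg (· ≤ _) (x.apply_symm_apply a))

theorem RespectsOrder.inv_apply_le {K : Finset (Fin m)} {w : Equiv.Perm (Fin (m + 1))}
    (hw : RespectsOrder K w) {a b : Fin (m + 1)} (hab : a ≤ b)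
    (h : ∀ c : Fin m, a ≤ c.castSucc → c.succ ≤ b → c ∈ K) : w⁻¹ a ≤ w⁻¹ b := by
  induction b using Fin.induction with
  | zero => rw [Fin.le_zero_iff.1 hab]
  | succ i ih =>
    rcases hab.lt_or_eq with h1 | rfl
    · have h2 : a ≤ i.castSucc := Fin.le_castSucc_iff.2 h1
      exact (ih h2 fun c hc hci => h c hc (hci.trans i.castSucc_lt_succ.le)).trans
        (hw i (h i h2 le_rfl)).le
    · exact le_rfl

/-- Inverted neighbours from `K` could be exchanged to shorten the word. Conversely, if `w` respects
`K`, inverted values are separated by a gap `c ∉ K`, which `u` does not cross, so `u` carries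
inversions of `w` injectively to inversions of `u * w`. -/
theorem mem_minCosetReps_iff {K : Finset (Fin m)} {w : Equiv.Perm (Fin (m + 1))} :
    w ∈ minCosetReps (K : Set (Fin m)) ↔ RespectsOrder K w := by
  constructor
  · intro hw k hk
    refine (inv_apply_lt_or_gt w k).resolve_right fun hlt => ?_
    have h1 := hw (adjTransposition k) (Subgroup.subset_closure ⟨k, hk, rfl⟩)
    rw [permLength_eq_card_inversions, permLength_eq_card_inversions,
      card_inversions_adjTransposition_mul_of_gt hlt] at h1
    omega
  · intro hw u hu
    rw [permLength_eq_card_inversions, permLength_eq_card_inversions]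
    refine Finset.card_le_card_of_injOn (Prod.map u u) ?_
      (Function.Injective.injOn (u.injective.prodMap u.injective))
    rintro ⟨a, b⟩ hab
    obtain ⟨h1, h2⟩ := mem_inversions.1 hab
    obtain ⟨c, hac, hcb, hc⟩ : ∃ c : Fin m, a ≤ c.castSucc ∧ c.succ ≤ b ∧ c ∉ K := by
      by_contra! hcon
      exact h2.not_ge (hw.inv_apply_le h1.le hcon)
    have h3 : u a ≤ c.castSucc := (le_castSucc_iff_of_mem_parabolic hu hc a).2 hac
    have h4 : ¬ u b ≤ c.castSucc := fun h =>
      ((le_castSucc_iff_of_mem_parabolic hu hc b).1 h).not_gt (c.castSucc_lt_succ.trans_le hcb)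
    have hinv : ∀ x, (u * w)⁻¹ (u x) = w⁻¹ x := fun x => by
      rw [mul_inv_rev, Equiv.Perm.mul_apply]
      exact congrArg _ (u.symm_apply_apply x)
    refine Finset.mem_coe.2 (mem_inversions.2 ⟨h3.trans_lt (not_le.1 h4), ?_⟩)
    rw [hinv, hinv]
    exact h2

end Length

/-! ## Reversal -/

section Reversal

variable {m : ℕ}

/-- The image of the complement of a set under the reversal. -/
def revCompl (S : Finset (Fin (m + 1))) : Finset (Fin (m + 1)) :=
  Finset.univ.filter fun v => v.rev ∉ S

theorem mem_revCompl {S : Finset (Fin (m + 1))} {v : Fin (m + 1)} :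
    v ∈ revCompl S ↔ v.rev ∉ S := by
  simp [revCompl]

theorem revCompl_involutive : Function.Involutive (revCompl (m := m)) := by
  intro S
  ext v
  simp [mem_revCompl]

theorem revCompl_subset {S T : Finset (Fin (m + 1))} (h : S ⊆ T) : revCompl T ⊆ revCompl S := by
  intro v hv
  rw [mem_revCompl] at hv ⊢
  exact fun hS => hv (h hS)

theorem image_involutive {α : Type*} [DecidableEq α] {f : α → α} (hf : Function.Involutive f)
    (s : Finset α) : (s.image f).image f = s := by
  rw [Finset.image_image, hf.comp_self, Finset.image_id]

/-- This is the combinatorial trace of `x_i ↦ -x_{n+1-i}`. That map replaces `p` by `-p`, but face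
data do not involve `p`. -/
theorem IsFaceDatum.reverse {K J : Finset (Fin m)} {C : Finset (Finset (Fin (m + 1)))}
    (h : IsFaceDatum K C J) :
    IsFaceDatum (K.image Fin.rev) (C.image revCompl) (J.image Fin.rev) := by
  refine ⟨⟨fun S hS => ?_, fun S hS => ?_, fun S hS T hT => ?_⟩,
    Finset.image_subset_image h.subset, fun S hS k hk => ?_, fun S hS k hk => ?_⟩ <;>
    obtain ⟨S, hS', rfl⟩ := Finset.mem_image.1 hS
  · by_contra hne
    rw [Finset.not_nonempty_iff_eq_empty] at hne
    refine h.chain.ne_univ S hS' (Finset.eq_univ_iff_forall.2 fun v => ?_)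
    by_contra hv
    have : v.rev ∈ revCompl S := by rwa [mem_revCompl, Fin.rev_rev]
    rw [hne] at this
    exact Finset.notMem_empty _ this
  · intro huniv
    obtain ⟨v, hv⟩ := h.chain.nonempty S hS'
    have : v.rev ∈ revCompl S := huniv ▸ Finset.mem_univ _
    rw [mem_revCompl, Fin.rev_rev] at this
    exact this hv
  · obtain ⟨T, hT', rfl⟩ := Finset.mem_image.1 hT
    exact (h.chain.total S hS' T hT').symm.imp revCompl_subset revCompl_subset
  · obtain ⟨k, hk', rfl⟩ := Finset.mem_image.1 hk
    rw [mem_revCompl, mem_revCompl, Fin.rev_succ, Fin.rev_castSucc, Fin.rev_rev]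
    exact fun h1 h2 => h1 (h.mem_of_succ_mem S hS' k hk' h2)
  · obtain ⟨k, hk', rfl⟩ := Finset.mem_image.1 hk
    rw [mem_revCompl, mem_revCompl, Fin.rev_succ, Fin.rev_castSucc, Fin.rev_rev]
    exact fun h1 h2 => h1 (h.succ_mem S hS' k hk' h2)

theorem sum_faceData_reverse (K : Finset (Fin m)) :
    ∑ d ∈ faceData K, (X - 1 : ℤ[X]) ^ (m - (d.1.card + d.2.card)) =
      ∑ d ∈ faceData (K.image Fin.rev), (X - 1) ^ (m - (d.1.card + d.2.card)) := by
  refine Finset.sum_nbij' (fun d => (d.1.image revCompl, d.2.image Fin.rev))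
    (fun d => (d.1.image revCompl, d.2.image Fin.rev)) ?_ ?_ ?_ ?_ ?_
  · intro d hd
    exact mem_faceData.2 (mem_faceData.1 hd).reverse
  · intro d hd
    have := (mem_faceData.1 hd).reverse
    rw [image_involutive Fin.rev_involutive] at this
    exact mem_faceData.2 this
  · intro d _
    simp only [image_involutive revCompl_involutive, image_involutive Fin.rev_involutive]
  · intro d _
    simp only [image_involutive revCompl_involutive, image_involutive Fin.rev_involutive]
  · intro d _
    simp only [Finset.card_image_of_injective _ revCompl_involutive.injective,
      Finset.card_image_of_injective _ Fin.rev_injective]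

/-- The word obtained by reversing both the positions and the values. -/
def revConj (w : Equiv.Perm (Fin (m + 1))) : Equiv.Perm (Fin (m + 1)) :=
  Fin.revPerm * w * Fin.revPerm

theorem revConj_apply (w : Equiv.Perm (Fin (m + 1))) (i : Fin (m + 1)) :
    revConj w i = (w i.rev).rev := rfl

theorem revConj_inv_apply (w : Equiv.Perm (Fin (m + 1))) (i : Fin (m + 1)) :
    (revConj w)⁻¹ i = (w⁻¹ i.rev).rev := rfl

theorem revConj_involutive : Function.Involutive (revConj (m := m)) := by
  intro w
  ext i
  simp [revConj_apply]

theorem mem_descents_revConj {w : Equiv.Perm (Fin (m + 1))} {i : Fin m} :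
    i ∈ descents (revConj w) ↔ i.rev ∈ descents w := by
  rw [mem_descents, mem_descents, revConj_apply, revConj_apply, Fin.rev_lt_rev, Fin.rev_succ,
    Fin.rev_castSucc]

theorem des_revConj (w : Equiv.Perm (Fin (m + 1))) : des (revConj w) = des w := by
  have : descents (revConj w) = (descents w).image Fin.rev := by
    ext i
    rw [mem_descents_revConj, Finset.mem_image]
    exact ⟨fun h => ⟨_, h, Fin.rev_rev i⟩, fun ⟨j, hj, h⟩ => by rwa [← h, Fin.rev_rev]⟩
  rw [des, des, this, Finset.card_image_of_injective _ Fin.rev_injective]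

theorem HasDoubleDescent.of_revConj {w : Equiv.Perm (Fin (m + 1))}
    (h : HasDoubleDescent (revConj w)) : HasDoubleDescent w := by
  obtain ⟨i, hi, j, hj, hij⟩ := h
  refine ⟨_, mem_descents_revConj.1 hj, _, mem_descents_revConj.1 hi, ?_⟩
  rw [Fin.val_rev, Fin.val_rev]
  omega

theorem hasDoubleDescent_revConj {w : Equiv.Perm (Fin (m + 1))} :
    HasDoubleDescent (revConj w) ↔ HasDoubleDescent w := by
  refine ⟨HasDoubleDescent.of_revConj, fun h => HasDoubleDescent.of_revConj ?_⟩
  rwa [revConj_involutive w]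

theorem hasInitialDescent_revConj {w : Equiv.Perm (Fin (m + 1))} :
    HasInitialDescent (revConj w) ↔ HasFinalDescent w := by
  constructor
  · rintro ⟨i, hi, h⟩
    refine ⟨_, mem_descents_revConj.1 hi, ?_⟩
    rw [Fin.val_rev]
    omega
  · rintro ⟨i, hi, h⟩
    refine ⟨i.rev, mem_descents_revConj.2 (by rwa [Fin.rev_rev]), ?_⟩
    rw [Fin.val_rev]
    omega

theorem respectsOrder_revConj {K : Finset (Fin m)} {w : Equiv.Perm (Fin (m + 1))} :
    RespectsOrder (K.image Fin.rev) (revConj w) ↔ RespectsOrder K w := by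
  rw [RespectsOrder, Finset.forall_mem_image]
  refine forall₂_congr fun k _ => ?_
  rw [revConj_inv_apply, revConj_inv_apply, Fin.rev_lt_rev, Fin.rev_succ, Fin.rev_castSucc,
    Fin.rev_rev]

-- The expansion for the reversed `K` is carried back by reversing positions and values of words,
-- which turns initial descents into final ones.
open scoped Classical in
theorem sum_faceData_eq_sum_noFinalDescent (K : Finset (Fin m)) :
    ∑ d ∈ faceData K, (X - 1 : ℤ[X]) ^ (m - (d.1.card + d.2.card)) =
      ∑ w with RespectsOrder K w ∧ ¬ HasDoubleDescent w ∧ ¬ HasFinalDescent w,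
        X ^ des w * (1 + X) ^ (m - 2 * des w) := by
  rw [sum_faceData_reverse, sum_faceData_eq_sum_isolated]
  have hiff : ∀ w : Equiv.Perm (Fin (m + 1)),
      (RespectsOrder (K.image Fin.rev) (revConj w) ∧ ¬ HasDoubleDescent (revConj w) ∧
        ¬ HasInitialDescent (revConj w)) ↔
      (RespectsOrder K w ∧ ¬ HasDoubleDescent w ∧ ¬ HasFinalDescent w) := fun w => by
    rw [respectsOrder_revConj, hasDoubleDescent_revConj, hasInitialDescent_revConj]
  refine Finset.sum_nbij' revConj revConj ?_ ?_ ?_ ?_ ?_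
  · intro w hw
    rw [Finset.mem_filter, ← hiff, revConj_involutive w]
    exact ⟨Finset.mem_univ _, (Finset.mem_filter.1 hw).2⟩
  · intro w hw
    rw [Finset.mem_filter, hiff]
    exact ⟨Finset.mem_univ _, (Finset.mem_filter.1 hw).2⟩
  · intro w _; exact revConj_involutive w
  · intro w _; exact revConj_involutive w
  · intro w _; rw [des_revConj]

end Reversal

/-! ## The `γ`-expansion -/

section Gamma

variable {m : ℕ}

/-- The lowest term of `X^i (1 + X)^(m - 2i)` is `X^i`, so the coefficients depend on `γ` through a
unitriangular system. -/
theorem gammaExpansion_injective {γ δ : ℕ → ℤ} (h : gammaExpansion m γ = gammaExpansion m δ)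
    {j : ℕ} (hj : j ≤ m / 2) : γ j = δ j := by
  induction j using Nat.strong_induction_on with
  | _ j ih =>
    have hcoeff : ∀ ε : ℕ → ℤ, (gammaExpansion m ε).coeff j =
        ∑ i ∈ Finset.range j, (C (ε i) * X ^ i * (1 + X) ^ (m - 2 * i) : ℤ[X]).coeff j + ε j := by
      intro ε
      have hterm : ∀ i, j ≤ i → (C (ε i) * X ^ i * (1 + X) ^ (m - 2 * i) : ℤ[X]).coeff j =
          if i = j then ε j else 0 := by
        intro i hi
        rw [mul_assoc, coeff_C_mul, coeff_X_pow_mul']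
        rcases hi.eq_or_lt with rfl | hi
        · simp [coeff_zero_eq_eval_zero]
        · rw [if_neg hi.not_ge, if_neg hi.ne', mul_zero]
      rw [gammaExpansion, finsetSum_coeff,
        ← Finset.sum_range_add_sum_Ico _ (show j ≤ m / 2 + 1 by omega)]
      congr 1
      rw [Finset.sum_congr rfl fun i hi => hterm i (Finset.mem_Ico.1 hi).1, Finset.sum_ite_eq',
        if_pos (Finset.mem_Ico.2 ⟨le_rfl, by omega⟩)]
    have h1 := congrArg (fun p => p.coeff j) h
    simp only [hcoeff] at h1
    rw [Finset.sum_congr rfl fun i hi => by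
      rw [ih i (Finset.mem_range.1 hi) (by have := Finset.mem_range.1 hi; omega)]] at h1
    exact add_left_cancel h1

open scoped Classical in
theorem sum_eq_gammaExpansion {s : Set (Equiv.Perm (Fin (m + 1)))}
    (hs : ∀ w ∈ s, 2 * des w ≤ m) :
    ∑ w with w ∈ s, (X : ℤ[X]) ^ des w * (1 + X) ^ (m - 2 * des w) =
      gammaExpansion m fun j => ({w ∈ s | des w = j}.ncard : ℤ) := by
  have hmaps : ∀ w ∈ Finset.univ.filter (· ∈ s), des w ∈ Finset.range (m / 2 + 1) := by
    intro w hw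
    have := hs w (Finset.mem_filter.1 hw).2
    rw [Finset.mem_range]
    omega
  rw [gammaExpansion, ← Finset.sum_fiberwise_of_maps_to hmaps]
  refine Finset.sum_congr rfl fun j _ => ?_
  have hcard : {w ∈ s | des w = j}.ncard =
      ((Finset.univ.filter (· ∈ s)).filter fun w => des w = j).card := by
    rw [← Set.ncard_coe_finset]
    congr 1
    ext w
    simp
  have hcongr : ∀ w ∈ (Finset.univ.filter (· ∈ s)).filter fun w => des w = j,
      (X : ℤ[X]) ^ des w * (1 + X) ^ (m - 2 * des w) = X ^ j * (1 + X) ^ (m - 2 * j) := by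
    intro w hw
    rw [(Finset.mem_filter.1 hw).2]
  rw [Finset.sum_congr rfl hcongr, Finset.sum_const, hcard, nsmul_eq_mul, mul_assoc]
  simp

theorem two_mul_des_le_of_mem_tildeReps {K : Set (Fin m)} {w : Equiv.Perm (Fin (m + 1))}
    (hw : w ∈ tildeReps K) : 2 * des w ≤ m :=
  two_mul_des_le hw.2.1 hw.2.2

theorem two_mul_des_le_of_mem_hatReps {K : Set (Fin m)} {w : Equiv.Perm (Fin (m + 1))}
    (hw : w ∈ hatReps K) : 2 * des w ≤ m := by
  rw [← des_revConj]
  refine two_mul_des_le (mt hasDoubleDescent_revConj.1 hw.2.1) (mt hasInitialDescent_revConj.1 hw.2.2)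

end Gamma

/-! ### Both expansions, uniqueness and the Eulerian case -/

theorem theorem3p2 (m : ℕ) (p : Fin (m + 1) → ℝ) (hp : Function.Injective p) (K : Set (Fin m)) :
    hPolynomial (partitionedPermutohedron p K) =
        gammaExpansion m (fun j => ({w ∈ tildeReps K | des w = j}.ncard : ℤ)) ∧
      (∀ j : ℕ, {w ∈ tildeReps K | des w = j}.ncard = {w ∈ hatReps K | des w = j}.ncard) ∧
      hPolynomial (partitionedPermutohedron p K) =
        ∑ᶠ w ∈ hatReps K, (X : ℤ[X]) ^ des w * (1 + X) ^ (m - 2 * des w) ∧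
      (∀ γ : ℕ → ℤ, hPolynomial (partitionedPermutohedron p K) = gammaExpansion m γ →
        ∀ j ≤ m / 2, γ j = ({w ∈ tildeReps K | des w = j}.ncard : ℤ) ∧
          γ j = ({w ∈ hatReps K | des w = j}.ncard : ℤ) ∧ 0 ≤ γ j) ∧
      (K = ∅ → minCosetReps K = Set.univ ∧
        hPolynomial (partitionedPermutohedron p K) =
          ∑ w : Equiv.Perm (Fin (m + 1)), (X : ℤ[X]) ^ des w) := by
  classical
  obtain ⟨K, rfl⟩ : ∃ K' : Finset (Fin m), (K' : Set (Fin m)) = K :=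
    ⟨K.toFinite.toFinset, by simp⟩
  have hh := hPolynomial_eq_sum_faceData hp K
  have htilde : ∀ w, w ∈ tildeReps (K : Set (Fin m)) ↔
      RespectsOrder K w ∧ ¬ HasDoubleDescent w ∧ ¬ HasInitialDescent w := fun w =>
    and_congr_left' mem_minCosetReps_iff
  have hhat : ∀ w, w ∈ hatReps (K : Set (Fin m)) ↔
      RespectsOrder K w ∧ ¬ HasDoubleDescent w ∧ ¬ HasFinalDescent w := fun w =>
    and_congr_left' mem_minCosetReps_iff
  have ht : hPolynomial (partitionedPermutohedron p K) =
      gammaExpansion m (fun j => ({w ∈ tildeReps (K : Set (Fin m)) | des w = j}.ncard : ℤ)) := by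
    rw [hh, sum_faceData_eq_sum_isolated,
      ← sum_eq_gammaExpansion fun w => two_mul_des_le_of_mem_tildeReps]
    simp only [htilde]
  have hs : hPolynomial (partitionedPermutohedron p K) =
      ∑ w with w ∈ hatReps (K : Set (Fin m)), X ^ des w * (1 + X) ^ (m - 2 * des w) := by
    rw [hh, sum_faceData_eq_sum_noFinalDescent]
    simp only [hhat]
  have hg : hPolynomial (partitionedPermutohedron p K) =
      gammaExpansion m (fun j => ({w ∈ hatReps (K : Set (Fin m)) | des w = j}.ncard : ℤ)) := by
    rw [hs, sum_eq_gammaExpansion fun w => two_mul_des_le_of_mem_hatReps]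
  refine ⟨ht, fun j => ?_, ?_, fun γ hγ j hj => ?_, fun hK => ⟨?_, ?_⟩⟩
  · by_cases hj : j ≤ m / 2
    · exact_mod_cast gammaExpansion_injective (ht.symm.trans hg) hj
    -- Uniqueness says nothing beyond `m / 2`, but `2 * des w ≤ m` leaves both sets empty there.
    · have h1 : {w ∈ tildeReps (K : Set (Fin m)) | des w = j} = ∅ := by
        refine Set.eq_empty_of_forall_notMem ?_
        rintro w ⟨hw, rfl⟩
        have := two_mul_des_le_of_mem_tildeReps hw
        omega
      have h2 : {w ∈ hatReps (K : Set (Fin m)) | des w = j} = ∅ := by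
        refine Set.eq_empty_of_forall_notMem ?_
        rintro w ⟨hw, rfl⟩
        have := two_mul_des_le_of_mem_hatReps hw
        omega
      rw [h1, h2]
  · rw [hs, finsum_mem_eq_finite_toFinset_sum _ (Set.toFinite _)]
    refine Finset.sum_congr ?_ fun _ _ => rfl
    ext w
    simp
  · have h1 := gammaExpansion_injective (hγ.symm.trans ht) hj
    have h2 := gammaExpansion_injective (hγ.symm.trans hg) hj
    exact ⟨h1, h2, h1 ▸ Int.natCast_nonneg _⟩
  · rw [Set.eq_univ_iff_forall]
    intro w
    obtain rfl : K = ∅ := Finset.coe_eq_empty.1 hK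
    exact mem_minCosetReps_iff.2 fun k hk => absurd hk (Finset.notMem_empty k)
  · obtain rfl : K = ∅ := Finset.coe_eq_empty.1 hK
    rw [hh, sum_faceData_empty]
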